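/- Let $\mathcal{M}$ be a bicomplete model category, $K$ a set of cofibrant objects of $\mathcal{M}$, and $T$ a monad on $\mathcal{M}$ such that the category $\mathrm{Alg}(T;\mathcal{M})$ of $T$-algebras is cocomplete (hence bicomplete); write $U$ for the forgetful functor and $T:\mathcal{M}\to \mathrm{Alg}(T;\mathcal{M})$ for its left adjoint, the free algebra functor. Mapping spaces $\mathrm{map}(X,A)$ are right homotopy function complexes: the simplicial set of maps from a cofibrant object $X$ into a simplicial resolution of $A$ (or, in a semi-model category, of an object weakly equivalent to $A$), i.e. a Reedy fibrant simplicial object that is levelwise weakly equivalent to the constant one. A map $f:A\to B$ is a $K$-colocal equivalence if $\mathrm{map}(X,A)\to\mathrm{map}(X,B)$ is a weak equivalence of simplicial sets for all $X\in K$; a cofibrant object $Y$ is $K$-colocal if $\mathrm{map}(Y,A)\to\mathrm{map}(Y,B)$ is a weak equivalence for all $K$-colocal equivalences $A\to B$. $R_K\mathcal{M}$ denotes the category $\mathcal{M}$ with the $K$-colocal equivalences as weak equivalences, with the fibrations of $\mathcal{M}$, and with the maps having the left lifting property against trivial fibrations as cofibrations. The same definitions are used for the set $T(K)$ of free algebras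 on objects of $K$ in $\mathrm{Alg}(T;\mathcal{M})$. A semi-model category over a category $\mathcal{B}$ with weak equivalences, fibrations and cofibrations is a bicomplete category $\mathcal{D}$ with a right adjoint $U:\mathcal{D}\to\mathcal{B}$ and three classes of maps (weak equivalences, fibrations, cofibrations) such that: (1) $U$ preserves and reflects fibrations and trivial fibrations; (2) weak equivalences satisfy 2-out-of-3, and the three classes are closed under retracts; (3) cofibrations have the left lifting property against trivial fibrations, and trivial cofibrations with cofibrant domain have it against fibrations; (4) every map factors functorially as a cofibration followed by a trivial fibration, and every map with cofibrant domain factors functorially as a trivial cofibration followed by a fibration; (5) $U$ of the initial object is cofibrant in $\mathcal{B}$; (6) fibrations and trivial fibrations are closed under pullback. "Cofibrant" in (3) and (4) means cofibrant in $\mathcal{D}$. For $\mathcal{B}=\mathcal{M}$ or $\mathcal{B}=R_K\mathcal{M}$, the category $\mathrm{Alg}(T;\mathcal{B})$ is semi-admissible over $\mathcal{B}$ if it is a semi-model category over $\mathcal{B}$ in which $f$ is a weak equivalence (fibration) if and only if $Uf$ is one in $\mathcal{B}$, and the cofibrations are the maps having the left lifting property against trivial fibrations. **Corollary.** Suppose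 that $R_K\mathcal{M}$ is a model category, that $\mathrm{Alg}(T;\mathcal{M})$ is semi-admissible over $\mathcal{M}$, and that one of the following two (equivalent) conditions holds: (i) $\mathrm{Alg}(T;R_K\mathcal{M})$ is semi-admissible over $R_K\mathcal{M}$; (ii) $R_{T(K)}\mathrm{Alg}(T;\mathcal{M})$ is a semi-model category (over $R_K\mathcal{M}$). Then the free functor $T:\mathcal{M}\to\mathrm{Alg}(T;\mathcal{M})$ sends $K$-colocal equivalences between $K$-colocal objects to $T(K)$-colocal equivalences between $T(K)$-colocal objects: if $f:X\to Y$ is a $K$-colocal equivalence and $X$, $Y$ are $K$-colocal, then $TX$ and $TY$ are $T(K)$-colocal and $Tf$ is a $T(K)$-colocal equivalence. -/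

import Mathlib

open CategoryTheory CategoryTheory.Limits HomotopicalAlgebra Opposite

universe v u u'

namespace Colocal

/-! ## Weak equivalences of simplicial sets -/

/-- A map `f : X ⟶ Y` of simplicial sets is a weak (homotopy) equivalence if for every Kan
complex `Z`, precomposition with `f` induces a bijection `[Y, Z] ≃ [X, Z]` on simplicial homotopy
classes of maps. (Simplicial homotopy is an equivalence relation, as `Z` is a Kan complex.) -/
def SSetWeakEquivalence {X Y : SSet.{v}} (f : X ⟶ Y) : Prop :=
  ∀ (Z : SSet.{v}), SSet.KanComplex Z →
    (∀ u : X ⟶ Z, ∃ g : Y ⟶ Z, Nonempty (SSet.Homotopy (f ≫ g) u)) ∧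
    (∀ g h : Y ⟶ Z, Nonempty (SSet.Homotopy (f ≫ g) (f ≫ h)) → Nonempty (SSet.Homotopy g h))

/-! ## Categories with three classes of maps -/

/-- Three classes of morphisms in a category. Several such structures on one category have to be
compared, so that this is a structure and not a class. -/
structure Classes (C : Type u) [Category.{v} C] where
  /-- the weak equivalences -/
  weq : MorphismProperty C
  /-- the fibrations -/
  fib : MorphismProperty C
  /-- the cofibrations -/
  cof : MorphismProperty C

/-- The three classes of a model category. -/
def modelClasses (C : Type u) [Category.{v} C] [ModelCategory C] : Classes C where
  weq := weakEquivalences C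
  fib := fibrations C
  cof := cofibrations C

/-- The weak equivalences `W` and the fibrations `F`, together with the class of maps with the
left lifting property with respect to `W ∩ F` as the cofibrations. In a (semi-)model category the
cofibrations are determined by `W` and `F` in this way. -/
def Classes.ofWeqFib {C : Type u} [Category.{v} C] (W F : MorphismProperty C) : Classes C where
  weq := W
  fib := F
  cof := (F ⊓ W).llp

/-- The three classes are the weak equivalences, the fibrations and the cofibrations of a model
category structure on `C`. -/
def Classes.IsModel {C : Type u} [Category.{v} C] (S : Classes C) : Prop :=
  ∃ R : ModelCategory C, @modelClasses C _ R = S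

namespace Classes

variable {C : Type u} [Category.{v} C] (S : Classes C)

/-- Trivial fibrations. -/
def trivFib : MorphismProperty C := S.fib ⊓ S.weq

/-- Trivial cofibrations. -/
def trivCof : MorphismProperty C := S.cof ⊓ S.weq

/-- Cofibrant objects. -/
def IsCofibrant [HasInitial C] (X : C) : Prop := S.cof (initial.to X)

end Classes

/-! ## Simplicial resolutions -/

section Matching

variable {C : Type u} [Category.{v} C]

/-- The category of non-identity injective monotone maps `[m] ⟶ n`. -/
abbrev ProperFace (n : SimplexCategory) : Type :=
  ObjectProperty.FullSubcategory (fun f : Over n => Mono f.hom ∧ ¬ IsIso f.hom)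

/-- The diagram `([m] ⟶ n) ↦ A m` on the opposite of the category of proper faces of `n`, whose
limit is the matching object of the simplicial object `A` at `n`. -/
abbrev matchingDiagram (A : SimplicialObject C) (n : SimplexCategory) :
    (ProperFace n)ᵒᵖ ⥤ C :=
  (ObjectProperty.ι _ ⋙ Over.forget n).op ⋙ A

/-- The cone over the matching diagram with point `A n`. -/
def matchingCone (A : SimplicialObject C) (n : SimplexCategory) :
    Cone (matchingDiagram A n) where
  pt := A.obj (op n)
  π :=
    { app := fun j => A.map (j.unop.obj.hom).op
      naturality := fun i j φ => by
        have h := Over.w φ.unop.hom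
        dsimp
        rw [Category.id_comp, ← A.map_comp, ← op_comp]
        exact congrArg (fun t => A.map (Quiver.Hom.op t)) h.symm }

/-- The matching map of the simplicial object `A` at `n`. -/
noncomputable def matchingMap [HasLimits C] (A : SimplicialObject C) (n : SimplexCategory) :
    A.obj (op n) ⟶ limit (matchingDiagram A n) :=
  limit.lift _ (matchingCone A n)

end Matching

namespace Classes

variable {C : Type u} [Category.{v} C] (S : Classes C)

/-- A simplicial object is Reedy fibrant if all its matching maps are fibrations. -/
def IsReedyFibrant [HasLimits C] (A : SimplicialObject C) : Prop :=
  ∀ n : SimplexCategory, S.fib (matchingMap A n)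

/-- A simplicial resolution of `A`: a levelwise weak equivalence from the constant simplicial
object at `A` to a Reedy fibrant simplicial object. -/
structure IsSimplicialResolution [HasLimits C] {A : C} {R : SimplicialObject C}
    (i : (SimplicialObject.const C).obj A ⟶ R) : Prop where
  weq : ∀ n : SimplexCategoryᵒᵖ, S.weq (i.app n)
  reedyFibrant : S.IsReedyFibrant R

/-- A simplicial resolution of a map `f : A ⟶ B`, up to weak equivalence: a map
`f' : A' ⟶ B'` weakly equivalent to `f`, together with simplicial resolutions of `A'` and of `B'`
and a map `res` of simplicial objects which extends `f'`. In a model category one can always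
take `f' = f`; in a semi-model category `f'` may have to be a cofibrant approximation of `f`,
since simplicial resolutions are only guaranteed to exist for cofibrant objects. -/
structure MapResolution [HasLimits C] {A B : C} (f : A ⟶ B) where
  /-- an object weakly equivalent to `A` -/
  A' : C
  /-- an object weakly equivalent to `B` -/
  B' : C
  /-- a map weakly equivalent to `f` -/
  f' : A' ⟶ B'
  /-- the comparison of the domains -/
  a : A' ⟶ A
  /-- the comparison of the codomains -/
  b : B' ⟶ B
  weq_a : S.weq a
  weq_b : S.weq b
  comm : a ≫ f = f' ≫ b
  /-- the resolution of the domain -/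
  RA : SimplicialObject C
  /-- the resolution of the codomain -/
  RB : SimplicialObject C
  /-- the coaugmentation of `RA` -/
  iA : (SimplicialObject.const C).obj A' ⟶ RA
  /-- the coaugmentation of `RB` -/
  iB : (SimplicialObject.const C).obj B' ⟶ RB
  resolution_iA : S.IsSimplicialResolution iA
  resolution_iB : S.IsSimplicialResolution iB
  /-- the map of resolutions -/
  res : RA ⟶ RB
  comm_res : iA ≫ res = (SimplicialObject.const C).map f' ≫ iB

end Classes

/-- The simplicial set `C(X, A•)`. When `X` is cofibrant and `A•` is a simplicial resolution of
`A`, this is the right homotopy function complex `map(X, A)`. -/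
def homComplex {C : Type u} [Category.{v} C] (X : C) (A : SimplicialObject C) : SSet.{v} :=
  A ⋙ coyoneda.obj (op X)

/-- The map `C(X, A•) ⟶ C(X, B•)` induced by `φ : A• ⟶ B•`. -/
def homComplexMap {C : Type u} [Category.{v} C] (X : C) {A B : SimplicialObject C} (φ : A ⟶ B) :
    homComplex X A ⟶ homComplex X B :=
  Functor.whiskerRight φ (coyoneda.obj (op X))

/-! ## Colocal equivalences, colocal objects, right Bousfield localization -/

namespace Classes

variable {C : Type u} [Category.{v} C] [HasLimits C] (S : Classes C)

/-- For `X` cofibrant, `f` induces a weak equivalence `map(X, A) ⟶ map(X, B)` of right homotopy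
function complexes (computed by any simplicial resolution of `f`). -/
def MapWeq (X : C) {A B : C} (f : A ⟶ B) : Prop :=
  ∀ P : S.MapResolution f, SSetWeakEquivalence (homComplexMap X P.res)

/-- The `K`-colocal equivalences, for a set `K` of cofibrant objects. -/
def colocalEquivalences (K : Set C) : MorphismProperty C :=
  fun _ _ f => ∀ X ∈ K, S.MapWeq X f

/-- The `K`-colocal objects. -/
structure IsColocal [HasInitial C] (K : Set C) (Y : C) : Prop where
  cofibrant : S.IsCofibrant Y
  mapWeq : ∀ ⦃A B : C⦄ (f : A ⟶ B), S.colocalEquivalences K f → S.MapWeq Y f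

/-- The classes of maps of the right Bousfield localization with respect to `K`: the weak
equivalences are the `K`-colocal equivalences, and the fibrations are unchanged. -/
def rightBousfield (K : Set C) : Classes C :=
  Classes.ofWeqFib (S.colocalEquivalences K) S.fib

end Classes

/-! ## Semi-model categories and algebras over a monad -/

/-- The classes `Q` of maps of `D` make `D` a semi-model category over the category `C` with the
classes `S`, along the right adjoint functor `U : D ⥤ C`. -/
structure IsSemiModel {C : Type u} [Category.{v} C] [HasInitial C] {D : Type u'} [Category.{v} D]
    [HasLimits D] [HasColimits D] (S : Classes C) (U : D ⥤ C) [U.IsRightAdjoint]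
    (Q : Classes D) : Prop where
  fib_iff : ∀ ⦃X Y : D⦄ (f : X ⟶ Y), Q.fib f ↔ S.fib (U.map f)
  trivFib_iff : ∀ ⦃X Y : D⦄ (f : X ⟶ Y), Q.trivFib f ↔ S.trivFib (U.map f)
  twoOutOfThree : Q.weq.HasTwoOutOfThreeProperty
  weq_retract : Q.weq.IsStableUnderRetracts
  fib_retract : Q.fib.IsStableUnderRetracts
  cof_retract : Q.cof.IsStableUnderRetracts
  /-- Cofibrations lift against trivial fibrations. -/
  lift_cof : ∀ ⦃A B X Y : D⦄ (i : A ⟶ B) (p : X ⟶ Y), Q.cof i → Q.trivFib p →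
    HasLiftingProperty i p
  /-- Trivial cofibrations with cofibrant domain lift against fibrations. -/
  lift_trivCof : ∀ ⦃A B X Y : D⦄ (i : A ⟶ B) (p : X ⟶ Y), Q.IsCofibrant A → Q.trivCof i →
    Q.fib p → HasLiftingProperty i p
  /-- Functorial factorization of all maps into a cofibration and a trivial fibration. -/
  factor_cof : MorphismProperty.HasFunctorialFactorization Q.cof Q.trivFib
  /-- Functorial factorization of the maps with cofibrant domain into a trivial cofibration and
  a fibration. -/
  factor_trivCof :
    ∃ (Z : ObjectProperty.FullSubcategory (fun f : Arrow D => Q.IsCofibrant f.left) ⥤ D)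
      (i : ObjectProperty.ι _ ⋙ Arrow.leftFunc ⟶ Z)
      (p : Z ⟶ ObjectProperty.ι _ ⋙ Arrow.rightFunc),
      ∀ f, Q.trivCof (i.app f) ∧ Q.fib (p.app f) ∧ i.app f ≫ p.app f = f.obj.hom
  initial_cofibrant : S.IsCofibrant (U.obj (⊥_ D))
  fib_baseChange : Q.fib.IsStableUnderBaseChange
  trivFib_baseChange : Q.trivFib.IsStableUnderBaseChange

section Algebras

variable {M : Type u} [Category.{v} M] (T : Monad M)

instance algebra_hasLimits [HasLimits M] : HasLimits T.Algebra :=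
  hasLimits_of_hasLimits_createsLimits T.forget

/-- The classes of maps on the category of `T`-algebras created by the forgetful functor from
the weak equivalences and the fibrations of `S`. -/
def algClasses (S : Classes M) : Classes T.Algebra :=
  Classes.ofWeqFib (S.weq.inverseImage T.forget) (S.fib.inverseImage T.forget)

/-- The category of `T`-algebras is semi-admissible over `M` with the classes `S`. -/
def IsSemiAdmissible [HasLimits M] [HasInitial M] [HasColimits T.Algebra] (S : Classes M) : Prop :=
  IsSemiModel S T.forget (algClasses T S)

/-- The set `T(K)` of free `T`-algebras on the objects of `K`. -/
def freeSet (K : Set M) : Set T.Algebra := T.free.obj '' K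

/-- The right Bousfield localization of `T`-algebras with respect to `T(K)` exists as a
semi-model category (over the right Bousfield localization of `M` with respect to `K`). -/
def HasFreeRightBousfield [HasLimits M] [HasInitial M] [HasColimits T.Algebra] (S : Classes M)
    (K : Set M) : Prop :=
  IsSemiModel (S.rightBousfield K) T.forget ((algClasses T S).rightBousfield (freeSet T K))

end Algebras

end Colocal

/-! Let `f : X ⟶ Y` be a colocal equivalence between colocal objects. Colocality makes map(X, f) and
map(Y, f) weak equivalences, and a Whitehead argument shows that `f` is already a weak equivalence
of `M` (`weakEquivalences_of_mapWeq`): surjectivity on π₀ for `Y` provides an inverse up to homotopy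
on one side, injectivity for `X` shows that it is one on the other side, and two-out-of-six
concludes. The free functor preserves weak equivalences between cofibrant objects by Ken Brown's
argument (`weq_free_map`), and weak equivalences of algebras are T(K)-colocal equivalences
(`colocalEquivalences_of_weq`).

That TX is colocal is an adjunction argument (`isColocal_free`). The forgetful functor U sends
resolutions of algebras to resolutions in `M`, and map(TZ, R) ≅ map(Z, UR). Hence U sends a
resolvable T(K)-colocal equivalence to a K-colocal one, which map(X, -) and therefore map(TX, -)
inverts.

`MapWeq` quantifies over all resolutions, so this needs independence of the resolution in `M`
(`Classes.MapResolution.sSetWeakEquivalence`), which takes most of the work. The necessary Reedy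
theory is set up through lifting against Leibniz tensors: every map of simplicial objects is a
levelwise weak equivalence followed by a relative Reedy fibration (`exists_factorization`), and a
relative Reedy fibration that is a levelwise weak equivalence becomes a trivial fibration under M(Z,
-) for cofibrant Z (`relFib_cofibrations`, `rlp_homComplexMap`). Two resolutions are then compared
through a third that maps to both (`sSetWeakEquivalence_of_zigzag`). -/

namespace Colocal

open MonoidalCategory CartesianMonoidalCategory Simplicial SSet.modelCategoryQuillen

/-! ## The homotopy relation -/

/-- The homotopy relation on maps of simplicial sets. -/
def Htpic {X Z : SSet.{v}} (f g : X ⟶ Z) : Prop := Nonempty (SSet.Homotopy f g)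

namespace Htpic

variable {X Y Z W : SSet.{v}}

/-- `SSet.Homotopy` is a homotopy relative to a subcomplex, here the empty one, so its field `rel`
is vacuous. -/
lemma iff_exists {f g : X ⟶ Z} :
    Htpic f g ↔ ∃ h : X ⊗ Δ[1] ⟶ Z, SSet.ι₀ ≫ h = f ∧ SSet.ι₁ ≫ h = g :=
  ⟨fun ⟨H⟩ => ⟨H.h, H.h₀, H.h₁⟩, fun ⟨h, h₀, h₁⟩ =>
    ⟨{ h := h, h₀ := h₀, h₁ := h₁, rel := by ext _ ⟨⟨_, hx⟩, _⟩; simp at hx }⟩⟩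

lemma refl (f : X ⟶ Z) : Htpic f f :=
  iff_exists.2 ⟨fst _ _ ≫ f, by simp, by simp⟩

lemma precomp {f g : X ⟶ Z} (H : Htpic f g) (e : W ⟶ X) : Htpic (e ≫ f) (e ≫ g) := by
  obtain ⟨h, rfl, rfl⟩ := iff_exists.1 H
  exact iff_exists.2 ⟨e ▷ _ ≫ h, by simp, by simp⟩

lemma postcomp {f g : X ⟶ Z} (H : Htpic f g) (e : Z ⟶ W) : Htpic (f ≫ e) (g ≫ e) := by
  obtain ⟨h, rfl, rfl⟩ := iff_exists.1 H
  exact iff_exists.2 ⟨h ≫ e, by simp, by simp⟩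

/-- The vertex of the internal hom which corresponds to a map. -/
noncomputable def vertex (f : X ⟶ Z) : Δ[0] ⟶ (ihom X).obj Z :=
  MonoidalClosed.curry (fst X Δ[0] ≫ f)

lemma whiskerLeft_δ_one (X : SSet.{v}) :
    X ◁ SSet.stdSimplex.δ (1 : Fin 2) = fst X Δ[0] ≫ SSet.ι₀ := by
  ext ⟨n⟩ ⟨x, y⟩
  · rfl
  · induction n using SimplexCategory.rec
    apply SSet.stdSimplex.ext
    intro i
    have h : ∀ k : Fin 1, Fin.succAbove (1 : Fin 2) k = 0 := by decide
    exact h _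

lemma whiskerLeft_δ_zero (X : SSet.{v}) :
    X ◁ SSet.stdSimplex.δ (0 : Fin 2) = fst X Δ[0] ≫ SSet.ι₁ := by
  ext ⟨n⟩ ⟨x, y⟩
  · rfl
  · induction n using SimplexCategory.rec
    apply SSet.stdSimplex.ext
    intro i
    have h : ∀ k : Fin 1, Fin.succAbove (0 : Fin 2) k = 1 := by decide
    exact h _

lemma fst_comp_injective {k k' : X ⟶ Z} (h : fst X Δ[0] ≫ k = fst X Δ[0] ≫ k') : k = k' := by
  simpa using lift (𝟙 X) (SSet.stdSimplex.isTerminalObj₀.from X) ≫= h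

/-- Currying turns homotopies into edges of the internal hom, where horns can be filled when `Z` is
Kan. The coface `δ 1` omits the vertex `1`, so it gives the source. -/
lemma iff_exists_edge {f g : X ⟶ Z} :
    Htpic f g ↔ ∃ e : Δ[1] ⟶ (ihom X).obj Z,
      SSet.stdSimplex.δ 1 ≫ e = vertex f ∧ SSet.stdSimplex.δ 0 ≫ e = vertex g := by
  rw [iff_exists]
  constructor
  · rintro ⟨h, rfl, rfl⟩
    refine ⟨MonoidalClosed.curry h, ?_, ?_⟩
    · rw [vertex, ← Category.assoc, ← whiskerLeft_δ_one]
      exact (MonoidalClosed.curry_natural_left _ _).symm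
    · rw [vertex, ← Category.assoc, ← whiskerLeft_δ_zero]
      exact (MonoidalClosed.curry_natural_left _ _).symm
  · rintro ⟨e, h₀, h₁⟩
    obtain ⟨h, rfl⟩ := ((ihom.adjunction X).homEquiv _ _).surjective e
    refine ⟨h, ?_, ?_⟩
    · apply fst_comp_injective
      rw [← Category.assoc, ← whiskerLeft_δ_one]
      exact MonoidalClosed.curry_injective ((MonoidalClosed.curry_natural_left _ _).trans h₀)
    · apply fst_comp_injective
      rw [← Category.assoc, ← whiskerLeft_δ_zero]
      exact MonoidalClosed.curry_injective ((MonoidalClosed.curry_natural_left _ _).trans h₁)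

lemma euclidean [SSet.KanComplex Z] {f g k : X ⟶ Z} (h₁ : Htpic f g) (h₂ : Htpic f k) :
    Htpic g k := by
  rw [iff_exists_edge] at *
  obtain ⟨e₁, h₁, h₁'⟩ := h₁
  obtain ⟨e₂, h₂, h₂'⟩ := h₂
  -- The two edges out of `f` form a horn at the vertex `0`; the missing face of a filler runs from
  -- `g` to `k`.
  have hc : SSet.horn.IsCompatible (i := (0 : Fin 3))
    (fun j _ => if j = 2 then e₁ else e₂) := by
      rw [SSet.horn.isCompatible_iff]
      intro j k hj hk hjk
      obtain rfl : j = 1 := by fin_cases j <;> fin_cases k <;> simp_all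
      obtain rfl : k = 2 := by fin_cases k <;> simp_all
      exact h₂.trans h₁.symm
  obtain ⟨φ, hφ⟩ := hc.exists_lift_of_kanComplex
  have hφ₂ : SSet.stdSimplex.δ 2 ≫ φ = e₁ := by simpa using hφ 2 (by simp)
  have hφ₁ : SSet.stdSimplex.δ 1 ≫ φ = e₂ := by simpa using hφ 1 (by simp)
  refine ⟨SSet.stdSimplex.δ 0 ≫ φ, ?_, ?_⟩
  · rw [← h₁', ← hφ₂, ← Category.assoc, ← Category.assoc]
    congr 1
    exact (SSet.stdSimplex.δ_comp_δ (n := 0) (i := 0) (j := 1) (by simp)).symm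
  · rw [← h₂', ← hφ₁, ← Category.assoc, ← Category.assoc]
    congr 1

lemma symm [SSet.KanComplex Z] {f g : X ⟶ Z} (h : Htpic f g) : Htpic g f :=
  h.euclidean (refl f)

lemma trans [SSet.KanComplex Z] {f g k : X ⟶ Z} (h₁ : Htpic f g) (h₂ : Htpic g k) :
    Htpic f k :=
  h₁.symm.euclidean h₂

end Htpic

/-! ## Weak equivalences of simplicial sets -/

/-- Two distinct values would exhaust {0, 1}, while simplices of the boundary are not surjective. -/
lemma boundary_one_asOrderHom_apply {n : SimplexCategoryᵒᵖ}
    (x : (∂Δ[1] : SSet.{v}).obj n) (i j : Fin (n.unop.len + 1)) :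
    SSet.stdSimplex.asOrderHom x.1 i = SSet.stdSimplex.asOrderHom x.1 j := by
  by_contra h
  refine x.2 fun k => ?_
  generalize SSet.stdSimplex.asOrderHom x.1 = α at h ⊢
  by_cases hi : α i = k
  · exact ⟨i, hi⟩
  · exact ⟨j, by omega⟩

/-- The map `X ⊗ ∂Δ[1] ⟶ Z` which is given by `f` at `0` and by `g` at `1`. -/
noncomputable def descBoundary {X Z : SSet.{v}} (f g : X ⟶ Z) :
    X ⊗ (∂Δ[1] : SSet.{v}) ⟶ Z where
  app n := ↾fun x => if SSet.stdSimplex.asOrderHom x.2.1 0 = 0 then f.app n x.1 else g.app n x.1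
  naturality n m θ := by
    ext ⟨x, y⟩
    have := boundary_one_asOrderHom_apply y 0 (θ.unop.toOrderHom 0)
    change (if SSet.stdSimplex.asOrderHom y.1 (θ.unop.toOrderHom 0) = 0 then
      f.app m (X.map θ x) else g.app m (X.map θ x)) =
      Z.map θ (if SSet.stdSimplex.asOrderHom y.1 0 = 0 then f.app n x else g.app n x)
    rw [← this]
    split_ifs
    · exact ConcreteCategory.congr_hom (f.naturality θ) x
    · exact ConcreteCategory.congr_hom (g.naturality θ) x

lemma descBoundary_comp {X Z W : SSet.{v}} (f g : X ⟶ Z) (p : Z ⟶ W) :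
    descBoundary f g ≫ p = descBoundary (f ≫ p) (g ≫ p) := by
  ext n ⟨x, y⟩
  change p.app n (if SSet.stdSimplex.asOrderHom y.1 0 = 0 then f.app n x else g.app n x) =
    if SSet.stdSimplex.asOrderHom y.1 0 = 0 then p.app n (f.app n x) else p.app n (g.app n x)
  split_ifs <;> rfl

lemma descBoundary_self {X Z : SSet.{v}} (f : X ⟶ Z) :
    descBoundary f f = fst _ _ ≫ f := by
  ext n ⟨x, y⟩
  exact ite_self _

lemma comp_eq_of_descBoundary {X Z : SSet.{v}} {f g : X ⟶ Z} {h : X ⊗ Δ[1] ⟶ Z}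
    (hh : X ◁ ∂Δ[1].ι ≫ h = descBoundary f g) : SSet.ι₀ ≫ h = f ∧ SSet.ι₁ ≫ h = g := by
  constructor
  · ext n x
    refine (ConcreteCategory.congr_hom (congr_app hh n) ⟨x, ⟨_, ?_⟩⟩).trans (if_pos ?_)
    · rfl
    · exact fun hs => by
        obtain ⟨k, hk⟩ := hs 1
        exact absurd hk (by change ¬ (0 : Fin 2) = 1; decide)
  · ext n x
    refine (ConcreteCategory.congr_hom (congr_app hh n) ⟨x, ⟨_, ?_⟩⟩).trans (if_neg ?_)
    · change ¬ (1 : Fin 2) = 0; decide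
    · exact fun hs => by
        obtain ⟨k, hk⟩ := hs 0
        exact absurd hk (by change ¬ (1 : Fin 2) = 0; decide)

namespace SSetWeakEquivalence

/-- Lifting against `∅ ⟶ Y` gives a section `s`, and lifting against `X ⊗ ∂Δ[1] ⟶ X ⊗ Δ[1]` gives a
homotopy from `p ≫ s` to the identity, so `p` is a homotopy equivalence. -/
lemma of_rlp {X Y : SSet.{v}} (p : X ⟶ Y) (hp : (MorphismProperty.monomorphisms SSet.{v}).rlp p) :
    SSetWeakEquivalence p := by
  have h₁ : HasLiftingProperty (initial.to Y) p :=
    hp _ (MorphismProperty.monomorphisms.infer_property _)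
  have sq : CommSq (initial.to X) (initial.to Y) p (𝟙 Y) := ⟨by simp⟩
  let s := sq.lift
  have hs : s ≫ p = 𝟙 _ := sq.fac_right
  have : Htpic (p ≫ s) (𝟙 X) := by
    rw [Htpic.iff_exists]
    have hi : Mono (X ◁ ∂Δ[1].ι) := by
      refine @NatTrans.mono_of_mono_app _ _ _ _ _ _ _ fun n => ?_
      rw [CategoryTheory.mono_iff_injective]
      rintro ⟨x, y⟩ ⟨x', y'⟩ h
      exact Prod.ext (show (x, y).1 = (x', y').1 from (congrArg (Prod.fst (α := X.obj n) (β := Δ[1].obj n)) h)) (Subtype.ext (congrArg (Prod.snd (α := X.obj n) (β := Δ[1].obj n)) h))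
    have : HasLiftingProperty (X ◁ ∂Δ[1].ι) p := hp _ hi
    have sq : CommSq (descBoundary (p ≫ s) (𝟙 X)) (X ◁ ∂Δ[1].ι) p (fst _ _ ≫ p) := ⟨by
      rw [descBoundary_comp, Category.assoc, hs, Category.comp_id, Category.id_comp,
        descBoundary_self]
      rfl⟩
    exact ⟨sq.lift, comp_eq_of_descBoundary sq.fac_left⟩
  refine fun Z _ => ⟨fun u => ⟨s ≫ u, ?_⟩, fun g h H => ?_⟩
  · have := Htpic.postcomp this u
    rwa [Category.assoc, Category.id_comp] at this
  · have := Htpic.precomp H s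
    rwa [reassoc_of% hs, reassoc_of% hs] at this

lemma of_isIso {X Y : SSet.{v}} (p : X ⟶ Y) [IsIso p] : SSetWeakEquivalence p :=
  of_rlp p (MorphismProperty.rlp_of_isIso _ _)

variable {X Y W : SSet.{v}} {φ : X ⟶ Y} {ψ : Y ⟶ W}

lemma comp (h₁ : SSetWeakEquivalence φ) (h₂ : SSetWeakEquivalence ψ) :
    SSetWeakEquivalence (φ ≫ ψ) := fun Z hZ => by
  refine ⟨fun u => ?_, fun g h H => ?_⟩
  · obtain ⟨g, hg⟩ := (h₁ Z hZ).1 u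
    obtain ⟨g', hg'⟩ := (h₂ Z hZ).1 g
    exact ⟨g', by simpa using! (Htpic.precomp hg' φ).trans hg⟩
  · exact (h₂ Z hZ).2 _ _ ((h₁ Z hZ).2 _ _ (by simpa using! H : Nonempty (SSet.Homotopy _ _)))

lemma of_precomp (h₁ : SSetWeakEquivalence φ) (h₂ : SSetWeakEquivalence (φ ≫ ψ)) :
    SSetWeakEquivalence ψ := fun Z hZ => by
  refine ⟨fun u => ?_, fun g h H => ?_⟩
  · obtain ⟨g, hg⟩ := (h₂ Z hZ).1 (φ ≫ u)
    exact ⟨g, (h₁ Z hZ).2 _ _ (by simpa using! hg)⟩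
  · exact (h₂ Z hZ).2 _ _ (by simpa using! Htpic.precomp H φ)

lemma of_postcomp (h₁ : SSetWeakEquivalence ψ) (h₂ : SSetWeakEquivalence (φ ≫ ψ)) :
    SSetWeakEquivalence φ := fun Z hZ => by
  refine ⟨fun u => ?_, fun g h H => ?_⟩
  · obtain ⟨g, hg⟩ := (h₂ Z hZ).1 u
    exact ⟨ψ ≫ g, by simpa using! hg⟩
  · obtain ⟨g', hg⟩ := (h₁ Z hZ).1 g
    obtain ⟨h', hh⟩ := (h₁ Z hZ).1 h
    have := (h₂ Z hZ).2 g' h' (by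
      simpa using! (Htpic.precomp hg φ).trans (Htpic.trans H (Htpic.precomp hh φ).symm))
    exact (Htpic.symm hg).trans ((Htpic.precomp this ψ).trans hh)

end SSetWeakEquivalence

/-! ## Connected components -/

/-- The constant simplicial set with values `S`. -/
abbrev constSSet (S : Type v) : SSet.{v} := (SimplicialObject.const (Type v)).obj S

lemma sset_map_map (X : SSet.{v}) {n m k : SimplexCategoryᵒᵖ} (f : n ⟶ m) (g : m ⟶ k)
    (x : X.obj n) : X.map g (X.map f x) = X.map (f ≫ g) x :=
  (ConcreteCategory.congr_hom (X.map_comp f g) x).symm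

lemma constSSet_map_app {X : SSet.{v}} {S : Type v} (g : X ⟶ constSSet S)
    {n m : SimplexCategoryᵒᵖ} (θ : n ⟶ m) (x : X.obj n) :
    g.app m (X.map θ x) = g.app n x :=
  ConcreteCategory.congr_hom (g.naturality θ) x

/-- The map to a constant simplicial set which corresponds to a function on vertices that takes
the same value on the ends of all edges. -/
def toConst {X : SSet.{v}} {S : Type v} (c : X _⦋0⦌ → S)
    (hc : ∀ e : X _⦋1⦌, c (X.δ 1 e) = c (X.δ 0 e)) : X ⟶ constSSet S where
  app n := ↾fun x => c (X.map (SimplexCategory.const ⦋0⦌ n.unop 0).op x)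
  naturality n m θ := by
    ext x
    induction n using Opposite.rec with | _ n
    induction n using SimplexCategory.rec with | _ n
    let k := θ.unop.toOrderHom 0
    have h := hc (X.map (SimplexCategory.mkOfLe 0 k (Fin.zero_le _)).op x)
    have e₁ : SimplexCategory.δ 1 ≫ SimplexCategory.mkOfLe 0 k (Fin.zero_le _) =
        SimplexCategory.const ⦋0⦌ ⦋n⦌ 0 := by
      ext i : 3
      obtain rfl : i = 0 := Subsingleton.elim (α := Fin 1) _ _
      rfl
    have e₀ : SimplexCategory.δ 0 ≫ SimplexCategory.mkOfLe 0 k (Fin.zero_le _) =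
        SimplexCategory.const ⦋0⦌ m.unop 0 ≫ θ.unop := by
      ext i : 3
      obtain rfl : i = 0 := Subsingleton.elim (α := Fin 1) _ _
      rfl
    have h₁ : X.δ 1 (X.map (SimplexCategory.mkOfLe 0 k (Fin.zero_le _)).op x) =
        X.map (SimplexCategory.const ⦋0⦌ ⦋n⦌ 0).op x := by
      rw [SimplicialObject.δ, sset_map_map, ← op_comp, e₁]
    have h₀ : X.δ 0 (X.map (SimplexCategory.mkOfLe 0 k (Fin.zero_le _)).op x) =
        X.map (SimplexCategory.const ⦋0⦌ m.unop 0).op (X.map θ x) := by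
      rw [SimplicialObject.δ, sset_map_map, sset_map_map, ← op_comp, e₀]
      rfl
    exact (congrArg c h₀).symm.trans (h.symm.trans (congrArg c h₁))

lemma toConst_app {X : SSet.{v}} {S : Type v} (c : X _⦋0⦌ → S)
    (hc : ∀ e : X _⦋1⦌, c (X.δ 1 e) = c (X.δ 0 e)) (x : X _⦋0⦌) :
    (toConst c hc).app _ x = c x := by
  refine congrArg c ?_
  rw [Subsingleton.elim (SimplexCategory.const ⦋0⦌ ⦋0⦌ 0) (𝟙 _)]
  exact ConcreteCategory.congr_hom (X.map_id _) x

/-- Horns are connected: if `k` is the initial vertex of a simplex `x` of the horn, the edge on `i`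
and `k` lies in the horn too, since adding `i` to its vertices gives nothing beyond `i` and the
vertices of `x`. -/
lemma horn_toConst_apply {n : ℕ} {i : Fin (n + 2)} {S : Type v}
    (g : (Λ[n + 1, i] : SSet.{v}) ⟶ constSSet S) : ∃ s : S, ∀ m x, g.app m x = s := by
  let v₀ : (Λ[n + 1, i] : SSet.{v}) _⦋0⦌ :=
    ⟨SSet.stdSimplex.objMk (OrderHom.const _ i), fun h => by
      obtain ⟨j, hj⟩ : ∃ j : Fin (n + 2), j ≠ i := exists_ne i
      obtain ⟨k, hk⟩ | hj' := h.symm ▸ Set.mem_univ j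
      · exact hj hk.symm
      · exact hj hj'⟩
  refine ⟨g.app _ v₀, fun m x => ?_⟩
  let k := SSet.stdSimplex.asOrderHom x.1 0
  -- The minimum and maximum orient the edge; which end is `i` is settled at the end.
  let α : Fin 2 →o Fin (n + 2) :=
    ⟨![min i k, max i k], by
      intro a b
      fin_cases a <;> fin_cases b <;> simp⟩
  let e : (Λ[n + 1, i] : SSet.{v}) _⦋1⦌ := ⟨SSet.stdSimplex.objMk α, fun h => x.2 (by
    rw [Set.eq_univ_iff_forall] at h ⊢
    intro j
    obtain ⟨a, ha⟩ | hj := h j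
    · change α a = j at ha
      have ha : j = i ∨ j = k := by
        subst ha
        revert a
        change ∀ a : Fin 2, _
        intro a
        fin_cases a
        · exact min_choice i k
        · exact max_choice i k
      obtain rfl | rfl := ha
      · exact Or.inr rfl
      · exact Or.inl ⟨0, rfl⟩
    · exact Or.inr hj)⟩
  have h₁ : ∀ a : Fin 2, α a = i → g.app _ e = g.app _ v₀ := fun a ha => by
    rw [← constSSet_map_app g (SimplexCategory.const ⦋0⦌ ⦋1⦌ a).op e]
    congr 1
    apply Subtype.ext
    apply SSet.stdSimplex.ext
    intro _
    exact ha
  have h₂ : ∀ a : Fin 2, α a = k → g.app _ e = g.app _ x := fun a ha => by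
    rw [← constSSet_map_app g (SimplexCategory.const ⦋0⦌ ⦋1⦌ a).op e,
      ← constSSet_map_app g (SimplexCategory.const ⦋0⦌ m.unop 0).op x]
    congr 1
    apply Subtype.ext
    apply SSet.stdSimplex.ext
    intro _
    exact ha
  obtain hle | hle := le_total i k
  · exact (h₂ 1 (max_eq_right hle)).symm.trans (h₁ 0 (min_eq_left hle))
  · exact (h₂ 0 (min_eq_right hle)).symm.trans (h₁ 1 (max_eq_left hle))

instance (S : Type v) : SSet.KanComplex (constSSet S) := by
  rw [SSet.KanComplex.iff]
  intro n i f hf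
  obtain ⟨s, hs⟩ := horn_toConst_apply hf.desc
  refine ⟨{ app m := ↾fun _ => s }, fun j hj => ?_⟩
  rw [← hf.ι_desc j hj]
  ext m x
  exact (hs _ _).symm

/-- The homotopy sends the edge `{x} × Δ[1]` to an edge of a discrete simplicial set, whose ends
agree. -/
lemma Htpic.eq_of_const {X : SSet.{v}} {S : Type v} {f g : X ⟶ constSSet S} (H : Htpic f g)
    (x : X _⦋0⦌) : f.app _ x = g.app _ x := by
  obtain ⟨h, rfl, rfl⟩ := Htpic.iff_exists.1 H
  let z : (X ⊗ Δ[1]) _⦋1⦌ := ⟨X.σ 0 x, SSet.stdSimplex.objEquiv.symm (𝟙 _)⟩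
  have hz : ∀ a : Fin 2, X.δ a (X.σ 0 x) = x := fun a => by
    rw [SimplicialObject.δ, SimplicialObject.σ, sset_map_map, ← op_comp,
      Subsingleton.elim (SimplexCategory.δ a ≫ SimplexCategory.σ 0) (𝟙 ⦋0⦌)]
    exact ConcreteCategory.congr_hom (X.map_id _) x
  have h₁ := constSSet_map_app h (SimplexCategory.δ 1).op z
  have h₀ := constSSet_map_app h (SimplexCategory.δ 0).op z
  refine Eq.trans ?_ (h₁.trans (h₀.symm.trans ?_))
  · exact congrArg (h.app _) (Prod.ext (hz 1).symm (SSet.stdSimplex.ext _ _ fun i => by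
      obtain rfl : i = 0 := Subsingleton.elim (α := Fin 1) _ _
      rfl))
  · exact congrArg (h.app _) (Prod.ext (hz 0) (SSet.stdSimplex.ext _ _ fun i => by
      obtain rfl : i = 0 := Subsingleton.elim (α := Fin 1) _ _
      rfl))

/-- Surjectivity on π₀. The indicator function of the components met by `φ` and the constant
function `True` agree after `φ`, hence are homotopic on `Y`, hence equal on vertices. The generated
equivalence relation is needed because `Y` is not assumed to be Kan. -/
lemma SSetWeakEquivalence.exists_eqvGen {X Y : SSet.{v}} {φ : X ⟶ Y} (h : SSetWeakEquivalence φ)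
    (y : Y _⦋0⦌) : ∃ x : X _⦋0⦌, Relation.EqvGen SSet.π₀Rel (φ.app _ x) y := by
  let c₁ : Y _⦋0⦌ → ULift.{v} Prop := fun y =>
    ⟨∃ x : X _⦋0⦌, Relation.EqvGen SSet.π₀Rel (φ.app _ x) y⟩
  let g₁ : Y ⟶ constSSet (ULift.{v} Prop) := toConst c₁ fun e => by
    refine congrArg ULift.up (propext (exists_congr fun x => ⟨fun h => ?_, fun h => ?_⟩))
    · exact h.trans _ _ _ (.rel _ _ ⟨.mk' e⟩)
    · exact h.trans _ _ _ (.symm _ _ (.rel _ _ ⟨.mk' e⟩))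
  let g₂ : Y ⟶ constSSet (ULift.{v} Prop) := toConst (fun _ => ⟨True⟩) fun _ => rfl
  have hφ : φ ≫ g₁ = φ ≫ g₂ := by
    ext n x
    refine congrArg ULift.up (propext ⟨fun _ => trivial, fun _ =>
      ⟨X.map (SimplexCategory.const ⦋0⦌ n.unop 0).op x, ?_⟩⟩)
    rw [show φ.app _ (X.map _ x) = Y.map (SimplexCategory.const ⦋0⦌ n.unop 0).op (φ.app _ x) from
      ConcreteCategory.congr_hom (φ.naturality _) x]
    exact .refl _
  have H := Htpic.eq_of_const ((h _ inferInstance).2 g₁ g₂ (hφ ▸ Htpic.refl _)) y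
  rw [toConst_app, toConst_app] at H
  exact (congrArg ULift.down H).mpr trivial

lemma eqvGen_map {X Y : SSet.{v}} (φ : X ⟶ Y) {x x' : X _⦋0⦌}
    (h : Relation.EqvGen SSet.π₀Rel x x') :
    Relation.EqvGen SSet.π₀Rel (φ.app _ x) (φ.app _ x') := by
  induction h with
  | rel x y h => exact .rel _ _ ⟨h.some.map φ⟩
  | refl x => exact .refl _
  | symm x y _ ih => exact ih.symm
  | trans x y z _ _ ih₁ ih₂ => exact ih₁.trans _ _ _ ih₂

lemma eq_of_eqvGen {X : SSet.{v}} {S : Type v} (g : X ⟶ constSSet S) {x x' : X _⦋0⦌}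
    (h : Relation.EqvGen SSet.π₀Rel x x') : g.app _ x = g.app _ x' := by
  induction h with
  | rel x y h =>
    obtain ⟨e⟩ := h
    have h₁ := constSSet_map_app g (SimplexCategory.δ 1).op e.edge
    have h₀ := constSSet_map_app g (SimplexCategory.δ 0).op e.edge
    exact (congrArg (g.app _) e.src_eq).symm.trans (h₁.trans
      (h₀.symm.trans (congrArg (g.app _) e.tgt_eq)))
  | refl x => rfl
  | symm x y _ ih => exact ih.symm
  | trans x y z _ _ ih₁ ih₂ => exact ih₁.trans ih₂

/-- Injectivity on π₀. The indicator function of the component of `x` factors through `φ` up to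
homotopy, so it cannot separate vertices whose images lie in one component. -/
lemma SSetWeakEquivalence.eqvGen {X Y : SSet.{v}} {φ : X ⟶ Y} (h : SSetWeakEquivalence φ)
    {x x' : X _⦋0⦌} (hx : Relation.EqvGen SSet.π₀Rel (φ.app _ x) (φ.app _ x')) : Relation.EqvGen SSet.π₀Rel x x' := by
  let u : X ⟶ constSSet (ULift.{v} Prop) :=
    toConst (fun y => ⟨Relation.EqvGen SSet.π₀Rel x y⟩) fun e => by
      refine congrArg ULift.up (propext ⟨fun h => ?_, fun h => ?_⟩)
      · exact h.trans _ _ _ (.rel _ _ ⟨.mk' e⟩)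
      · exact h.trans _ _ _ (.symm _ _ (.rel _ _ ⟨.mk' e⟩))
  obtain ⟨g, hg⟩ := (h _ inferInstance).1 u
  have h₁ := Htpic.eq_of_const hg x
  have h₂ := Htpic.eq_of_const hg x'
  have h₃ : (φ ≫ g).app _ x = (φ ≫ g).app _ x' := eq_of_eqvGen g hx
  rw [toConst_app] at h₁ h₂
  exact (congrArg ULift.down (h₁.symm.trans (h₃.trans h₂))).mp (.refl _)

end Colocal

namespace Colocal

open Simplicial

/-! ## The boundary of a simplex and matching objects -/

/-- A proper face as a simplex of the boundary. -/
def faceSimplex {n : ℕ} (m : ProperFace ⦋n⦌) : (∂Δ[n] : SSet.{v}).obj (op m.obj.left) :=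
  ⟨SSet.stdSimplex.objEquiv.symm m.obj.hom, fun h => m.property.2 (by
    have := m.property.1
    have : Epi m.obj.hom := SimplexCategory.epi_iff_surjective.2 h
    exact isIso_of_mono_of_epi _)⟩

lemma map_faceSimplex {n : ℕ} {m m' : ProperFace ⦋n⦌} (φ : m ⟶ m') :
    (∂Δ[n] : SSet.{v}).map φ.hom.left.op (faceSimplex m') = faceSimplex m :=
  Subtype.ext (congrArg SSet.stdSimplex.objEquiv.symm (Over.w φ.hom))

/-- This is the epi-mono factorization in the simplex category; the mono part is proper because a
boundary simplex is not surjective. -/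
lemma exists_eq_map_faceSimplex {n : ℕ} {k : SimplexCategoryᵒᵖ} (x : (∂Δ[n] : SSet.{v}).obj k) :
    ∃ (m : ProperFace ⦋n⦌) (e : k.unop ⟶ m.obj.left), Epi e ∧
      (∂Δ[n] : SSet.{v}).map e.op (faceSimplex m) = x := by
  let θ := SSet.stdSimplex.objEquiv x.1
  refine ⟨⟨Over.mk (image.ι θ), inferInstanceAs (Mono (image.ι θ)), fun h => x.2 ?_⟩,
    factorThruImage θ, inferInstance,
    Subtype.ext (congrArg SSet.stdSimplex.objEquiv.symm (image.fac θ))⟩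
  have : IsIso (image.ι θ) := h
  have : Epi (factorThruImage θ ≫ image.ι θ) := inferInstance
  rw [image.fac] at this
  exact SimplexCategory.epi_iff_surjective.1 this

/-- The strong epimorphism `e` lifts against the monomorphism `m'`. This makes the values of a
compatible family on faces independent of how a boundary simplex is presented. -/
lemma exists_hom_of_map_faceSimplex_eq {n : ℕ} {k : SimplexCategoryᵒᵖ} {m m' : ProperFace ⦋n⦌}
    (e : k.unop ⟶ m.obj.left) [Epi e] (e' : k.unop ⟶ m'.obj.left)
    (h : (∂Δ[n] : SSet.{v}).map e.op (faceSimplex m) = (∂Δ[n] : SSet.{v}).map e'.op (faceSimplex m')) :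
    ∃ φ : m ⟶ m', e ≫ φ.hom.left = e' := by
  have := m'.property.1
  have h' : e ≫ m.obj.hom = e' ≫ m'.obj.hom :=
    SSet.stdSimplex.objEquiv.symm.injective (congrArg Subtype.val h)
  have : StrongEpi e := strongEpi_of_epi e
  have sq : CommSq e' e m'.obj.hom m.obj.hom := ⟨h'.symm⟩
  exact ⟨ObjectProperty.homMk (Over.homMk sq.lift sq.fac_right), sq.fac_left⟩

lemma boundary_hom_ext {n : ℕ} {Q : SSet.{v}} {f g : (∂Δ[n] : SSet.{v}) ⟶ Q}
    (h : ∀ m, f.app _ (faceSimplex m) = g.app _ (faceSimplex m)) : f = g := by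
  ext k x
  obtain ⟨m, e, -, rfl⟩ := exists_eq_map_faceSimplex x
  refine (ConcreteCategory.congr_hom (f.naturality e.op) _).trans
    (Eq.trans ?_ (ConcreteCategory.congr_hom (g.naturality e.op) _).symm)
  exact congrArg (Q.map e.op) (h m)

/-- With `boundary_hom_ext`, this says that the boundary is the colimit of its proper faces. The map
is defined by chosen presentations; `key` removes the choice and thereby gives naturality. -/
lemma exists_boundary_hom {n : ℕ} {Q : SSet.{v}} (z : ∀ m : ProperFace ⦋n⦌, Q.obj (op m.obj.left))
    (hz : ∀ ⦃m m' : ProperFace ⦋n⦌⦄ (φ : m ⟶ m'), Q.map φ.hom.left.op (z m') = z m) :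
    ∃ f : (∂Δ[n] : SSet.{v}) ⟶ Q, ∀ m, f.app _ (faceSimplex m) = z m := by
  choose m e he hx using fun (k : SimplexCategoryᵒᵖ) (x : (∂Δ[n] : SSet.{v}).obj k) =>
    exists_eq_map_faceSimplex x
  have key : ∀ (k : SimplexCategoryᵒᵖ) (x : (∂Δ[n] : SSet.{v}).obj k) (m' : ProperFace ⦋n⦌)
      (e' : k.unop ⟶ m'.obj.left), (∂Δ[n] : SSet.{v}).map e'.op (faceSimplex m') = x →
        Q.map (e k x).op (z (m k x)) = Q.map e'.op (z m') := fun k x m' e' h => by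
    have := he k x
    obtain ⟨φ, hφ⟩ := exists_hom_of_map_faceSimplex_eq (e k x) e' ((hx k x).trans h.symm)
    rw [← hz φ, sset_map_map, ← op_comp, hφ]
  refine ⟨{ app k := ↾fun x => Q.map (e k x).op (z (m k x)), naturality := fun k k' θ => ?_ },
    fun m' => ?_⟩
  · ext x
    refine (key k' _ (m k x) (θ.unop ≫ e k x) ?_).trans ?_
    · conv_rhs => rw [← hx k x]
      exact (sset_map_map _ _ _ _).symm
    · exact (sset_map_map _ _ _ _).symm
  · refine (key _ _ m' (𝟙 _) ?_).trans ?_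
    · exact ConcreteCategory.congr_hom ((∂Δ[n] : SSet.{v}).map_id _) _
    · exact ConcreteCategory.congr_hom (Q.map_id _) _

/-! ### Function complexes: simplices, boundaries and matching objects -/

section

variable {C : Type u} [Category.{v} C]

/-- Precomposition `C(D, R•) ⟶ C(C, R•)`. -/
def homComplexPrecomp {X Y : C} (i : X ⟶ Y) (R : SimplicialObject C) :
    homComplex Y R ⟶ homComplex X R :=
  Functor.whiskerLeft R (coyoneda.map i.op)

/-- The map from the standard simplex to `C(X, R•)` which corresponds to a map `X ⟶ R n`. -/
def homComplexSimplex {X : C} {R : SimplicialObject C} {n : ℕ} (x : X ⟶ R _⦋n⦌) :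
    Δ[n] ⟶ homComplex X R :=
  SSet.yonedaEquiv.symm x

lemma homComplexSimplex_surjective {X : C} {R : SimplicialObject C} {n : ℕ}
    (f : Δ[n] ⟶ homComplex X R) : ∃ x : X ⟶ R _⦋n⦌, homComplexSimplex x = f :=
  SSet.yonedaEquiv.symm.surjective f

lemma homComplexSimplex_injective {X : C} {R : SimplicialObject C} {n : ℕ} {x y : X ⟶ R _⦋n⦌}
    (h : homComplexSimplex x = homComplexSimplex y) : x = y :=
  SSet.yonedaEquiv.symm.injective h

lemma homComplexSimplex_precomp {X Y : C} (i : X ⟶ Y) {R : SimplicialObject C} {n : ℕ}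
    (x : Y ⟶ R _⦋n⦌) :
    homComplexSimplex x ≫ homComplexPrecomp i R = homComplexSimplex (i ≫ x) :=
  SSet.yonedaEquiv_symm_comp _ _

lemma homComplexSimplex_map {X : C} {R R' : SimplicialObject C} (ψ : R ⟶ R') {n : ℕ}
    (x : X ⟶ R _⦋n⦌) :
    homComplexSimplex x ≫ homComplexMap X ψ = homComplexSimplex (x ≫ ψ.app _) :=
  SSet.yonedaEquiv_symm_comp _ _

variable [HasLimits C]

/-- The map on matching objects induced by a map of simplicial objects. -/
noncomputable def matchingObjMap {R R' : SimplicialObject C} (ψ : R ⟶ R') (n : SimplexCategory) :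
    limit (matchingDiagram R n) ⟶ limit (matchingDiagram R' n) :=
  limMap (Functor.whiskerLeft _ ψ)

@[simp]
lemma matchingObjMap_π {R R' : SimplicialObject C} (ψ : R ⟶ R') (n : SimplexCategory)
    (m : (ProperFace n)ᵒᵖ) :
    matchingObjMap ψ n ≫ limit.π (matchingDiagram R' n) m =
      limit.π (matchingDiagram R n) m ≫ ψ.app (op m.unop.obj.left) :=
  limMap_π _ _

@[simp]
lemma matchingMap_π (R : SimplicialObject C) (n : SimplexCategory) (m : (ProperFace n)ᵒᵖ) :
    matchingMap R n ≫ limit.π (matchingDiagram R n) m = R.map m.unop.obj.hom.op :=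
  limit.lift_π _ _

lemma matchingMap_naturality {R R' : SimplicialObject C} (ψ : R ⟶ R') (n : SimplexCategory) :
    matchingMap R n ≫ matchingObjMap ψ n = ψ.app (op n) ≫ matchingMap R' n := by
  apply limit.hom_ext
  intro m
  rw [Category.assoc, matchingObjMap_π, Category.assoc, matchingMap_π]
  exact (Category.assoc _ _ _).symm.trans
    ((congrArg (· ≫ ψ.app _) (matchingMap_π R n m)).trans (ψ.naturality _))

lemma exists_toBoundary {X : C} {R : SimplicialObject C} {n : ℕ}
    (x : X ⟶ limit (matchingDiagram R ⦋n⦌)) :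
    ∃ f : (∂Δ[n] : SSet.{v}) ⟶ homComplex X R, ∀ m,
      f.app _ (faceSimplex m) = x ≫ limit.π (matchingDiagram R ⦋n⦌) (op m) :=
  exists_boundary_hom (Q := homComplex X R)
    (fun m => x ≫ limit.π (matchingDiagram R ⦋n⦌) (op m)) fun m m' φ => by
      have := limit.w (matchingDiagram R ⦋n⦌) φ.op
      exact (Category.assoc _ _ _).trans (congrArg (x ≫ ·) this)

/-- The map from the boundary to `C(X, R•)` which corresponds to a map from `X` to the
matching object. -/
noncomputable def toBoundary {X : C} {R : SimplicialObject C} {n : ℕ}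
    (x : X ⟶ limit (matchingDiagram R ⦋n⦌)) : (∂Δ[n] : SSet.{v}) ⟶ homComplex X R :=
  (exists_toBoundary x).choose

lemma toBoundary_app {X : C} {R : SimplicialObject C} {n : ℕ}
    (x : X ⟶ limit (matchingDiagram R ⦋n⦌)) (m : ProperFace ⦋n⦌) :
    (toBoundary x).app _ (faceSimplex m) = x ≫ limit.π (matchingDiagram R ⦋n⦌) (op m) :=
  (exists_toBoundary x).choose_spec m

lemma toBoundary_injective {X : C} {R : SimplicialObject C} {n : ℕ}
    {x y : X ⟶ limit (matchingDiagram R ⦋n⦌)} (h : toBoundary x = toBoundary y) : x = y := by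
  apply limit.hom_ext
  intro m
  exact (toBoundary_app x m.unop).symm.trans (Eq.trans (by rw [h]) (toBoundary_app y m.unop))

lemma toBoundary_surjective {X : C} {R : SimplicialObject C} {n : ℕ}
    (f : (∂Δ[n] : SSet.{v}) ⟶ homComplex X R) :
    ∃ x : X ⟶ limit (matchingDiagram R ⦋n⦌), toBoundary x = f := by
  let c : Cone (matchingDiagram R ⦋n⦌) :=
    { pt := X
      π :=
        { app m := f.app _ (faceSimplex m.unop)
          naturality m m' φ := by
            have h₁ := ConcreteCategory.congr_hom (f.naturality φ.unop.hom.left.op)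
              (faceSimplex m.unop)
            have h₂ := map_faceSimplex.{v} φ.unop
            refine (Category.id_comp _).trans (Eq.trans ?_ h₁)
            exact congrArg (f.app _) h₂.symm } }
  refine ⟨limit.lift _ c, boundary_hom_ext fun m => ?_⟩
  rw [toBoundary_app]
  exact limit.lift_π c _

lemma toBoundary_precomp {X Y : C} (i : X ⟶ Y) {R : SimplicialObject C} {n : ℕ}
    (x : Y ⟶ limit (matchingDiagram R ⦋n⦌)) :
    toBoundary x ≫ homComplexPrecomp i R = toBoundary (i ≫ x) := by
  refine boundary_hom_ext fun m => ?_
  rw [toBoundary_app, Category.assoc, ← toBoundary_app]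
  rfl

lemma toBoundary_map {X : C} {R R' : SimplicialObject C} (ψ : R ⟶ R') {n : ℕ}
    (x : X ⟶ limit (matchingDiagram R ⦋n⦌)) :
    toBoundary x ≫ homComplexMap X ψ = toBoundary (x ≫ matchingObjMap ψ _) := by
  refine boundary_hom_ext fun m => ?_
  rw [toBoundary_app, Category.assoc, matchingObjMap_π]
  exact (congrArg (· ≫ ψ.app _) (toBoundary_app x m)).trans (Category.assoc _ _ _)

/-- This is the dictionary entry that translates extension problems along a boundary into lifting
problems against matching maps. -/
lemma boundary_ι_homComplexSimplex {X : C} {R : SimplicialObject C} {n : ℕ} (x : X ⟶ R _⦋n⦌) :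
    ∂Δ[n].ι ≫ homComplexSimplex x = toBoundary (x ≫ matchingMap R _) := by
  refine boundary_hom_ext fun m => ?_
  rw [toBoundary_app, Category.assoc, matchingMap_π]
  rfl

end

end Colocal

namespace Colocal

open Simplicial

/-! ## Tensors with simplicial sets and relative Reedy fibrations -/

section

variable (M : Type u) [Category.{v} M]

/-- The bifunctor `(X, R•) ↦ M(X, R•)`. -/
abbrev homBifunctor : Mᵒᵖ ⥤ SimplicialObject M ⥤ SSet.{v} :=
  coyoneda ⋙ Functor.whiskeringRight SimplexCategoryᵒᵖ M (Type v)

variable [HasColimits M]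

/-- The tensor of an object of `M` with a simplicial set. -/
noncomputable abbrev tensor : M ⥤ SSet.{v} ⥤ SimplicialObject M :=
  sigmaConst.{v} ⋙ Functor.whiskeringRight SimplexCategoryᵒᵖ (Type v) M

/-- Copowers are left adjoint to representable functors. -/
noncomputable def sigmaConstAdjParam : (sigmaConst.{v} : M ⥤ Type v ⥤ M) ⊣₂ coyoneda where
  adj X := sigmaConstAdj X
  unit_whiskerRight_map {X Y} f := by
    ext S s
    exact Sigma.ι_map (fun _ : S => f) s

/-- Tensors are left adjoint to the functors `M(X, -)`. -/
noncomputable def tensorAdj : tensor M ⊣₂ homBifunctor M where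
  adj X := (sigmaConstAdj X).whiskerRight _
  unit_whiskerRight_map {X Y} f := by
    ext A n s
    have := NatTrans.congr_app ((sigmaConstAdjParam M).unit_whiskerRight_map f) (A.obj n)
    exact ConcreteCategory.congr_hom this s

end

/-- Applied to Leibniz homs and to relative matching maps, this unfolds both kinds of lifting
problem into the same three pieces of data. -/
lemma lifting_pullback_iff {C : Type*} [Category C] {A B E P X Y Z : C} (j : A ⟶ B)
    {e : E ⟶ X} {f : E ⟶ Y} {g : X ⟶ Z} {h : Y ⟶ Z} {p : P ⟶ X} {q : P ⟶ Y}
    (sq : IsPullback p q g h) {π : E ⟶ P} (hp : π ≫ p = e) (hq : π ≫ q = f) :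
    HasLiftingProperty j π ↔ ∀ (t : A ⟶ E) (x : B ⟶ X) (z : B ⟶ Y), t ≫ e = j ≫ x →
      t ≫ f = j ≫ z → x ≫ g = z ≫ h → ∃ l : B ⟶ E, j ≫ l = t ∧ l ≫ e = x ∧ l ≫ f = z := by
  subst hp hq
  refine ⟨fun H t x z h₁ h₂ h₃ => ?_, fun H => ⟨fun {t b} s => ?_⟩⟩
  · have s : CommSq t j π (sq.lift x z h₃) := ⟨by apply sq.hom_ext <;> simpa⟩
    refine ⟨s.lift, s.fac_left, ?_, ?_⟩
    · rw [s.fac_right_assoc, sq.lift_fst]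
    · rw [s.fac_right_assoc, sq.lift_snd]
  · obtain ⟨l, hl, h₁, h₂⟩ := H t (b ≫ p) (b ≫ q) (by simp [s.w_assoc]) (by simp [s.w_assoc])
      (by simp [sq.w])
    exact ⟨⟨{ l := l, fac_left := hl, fac_right := sq.hom_ext (by simpa) (by simpa) }⟩⟩

section

variable {M : Type u} [Category.{v} M]

/-- The Leibniz cotensor, with values in simplicial sets. -/
noncomputable def pullbackHom {X Y : M} (i : X ⟶ Y) {R R' : SimplicialObject M} (ψ : R ⟶ R') :
    (homBifunctor M).PullbackObjObj i ψ :=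
  .ofHasPullback _ i ψ

variable [HasColimits M]

/-- The Leibniz tensor of a map of `M` with a map of simplicial sets. -/
noncomputable def corner {X Y : M} (i : X ⟶ Y) {A B : SSet.{v}} (j : A ⟶ B) :
    (Functor.PushoutObjObj.ofHasPushout (tensor M) i j).pt ⟶ ((tensor M).obj Y).obj B :=
  (Functor.PushoutObjObj.ofHasPushout (tensor M) i j).ι

/-- The Leibniz tensors of the maps in `L` with monomorphisms of simplicial sets. -/
inductive corners (L : MorphismProperty M) : MorphismProperty (SimplicialObject M) where
  | mk {X Y : M} (i : X ⟶ Y) {A B : SSet.{v}} (j : A ⟶ B) (hi : L i) (hj : Mono j) :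
    corners L (corner i j)

/-- The maps of simplicial objects whose relative matching maps have the right lifting property
with respect to `L`. -/
def relFib (L : MorphismProperty M) : MorphismProperty (SimplicialObject M) :=
  (corners L).rlp

/-- Since M(∅, R) is terminal, the Leibniz hom of `∅ ⟶ Z` with `ψ` is just M(Z, ψ). -/
instance (R : SimplicialObject M) :
    PreservesLimitsOfShape (Discrete PEmpty.{1}) ((homBifunctor M).flip.obj R) :=
  preservesLimitsOfShape_of_evaluation _ _ fun n =>
    inferInstanceAs (PreservesLimitsOfShape _ (yoneda.obj (R.obj n)))

/-- For `Z` with `∅ ⟶ Z` in `L`, the functor `M(Z, -)` sends `L`-fibrations to trivial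
fibrations of simplicial sets. -/
lemma rlp_homComplexMap {L : MorphismProperty M} {Z : M} (hZ : L (initial.to Z))
    {R R' : SimplicialObject M} {ψ : R ⟶ R'} (hψ : relFib L ψ) :
    (MorphismProperty.monomorphisms SSet.{v}).rlp (homComplexMap Z ψ) := by
  intro A B j hj
  exact ((tensorAdj M).hasLiftingProperty_iff (.ofHasPushout _ _ _)
    (Functor.PullbackObjObj.ofIsInitial (homBifunctor M) (initial.to Z) ψ initialIsInitial)).1
    (hψ _ ⟨_, j, hZ, hj⟩)

lemma corner_lifting_iff {X Y : M} (i : X ⟶ Y) {A B : SSet.{v}} (j : A ⟶ B)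
    {R R' : SimplicialObject M} (ψ : R ⟶ R') :
    HasLiftingProperty (corner i j) ψ ↔ HasLiftingProperty j (pullbackHom i ψ).π :=
  (tensorAdj M).hasLiftingProperty_iff _ _

/-- Lifting against the boundary inclusions already implies lifting against all monomorphisms. -/
lemma relFib_iff_boundary (L : MorphismProperty M) {R R' : SimplicialObject M} (ψ : R ⟶ R') :
    relFib L ψ ↔ ∀ ⦃X Y : M⦄ (i : X ⟶ Y), L i → ∀ n : ℕ,
      HasLiftingProperty ∂Δ[n].ι (pullbackHom i ψ).π := by
  refine ⟨fun h X Y i hi n => (corner_lifting_iff _ _ _).1 (h _ ⟨i, _, hi, inferInstance⟩), ?_⟩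
  rintro h _ _ _ ⟨i, j, hi, hj⟩
  rw [corner_lifting_iff]
  have : (MorphismProperty.monomorphisms SSet.{v}).rlp (pullbackHom i ψ).π := by
    rw [SSet.rlp_monomorphisms]
    rintro _ _ _ ⟨n⟩
    exact h i hi n
  exact this _ hj

end

/-! ### Relative matching maps -/

section

variable {M : Type u} [Category.{v} M] [HasLimits M]

/-- The relative matching map. -/
noncomputable def relMatchingMap {R R' : SimplicialObject M} (ψ : R ⟶ R') (n : SimplexCategory) :
    R.obj (op n) ⟶ pullback (matchingObjMap ψ n) (matchingMap R' n) :=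
  pullback.lift (matchingMap R n) (ψ.app (op n)) (matchingMap_naturality ψ n)

/-- Maps from `Δ[n]` to M(X, R) are maps from X to `R n`, and maps from `∂Δ[n]` are maps from X to
the matching object; under this dictionary the two lifting problems coincide. -/
lemma boundary_lifting_iff {X Y : M} (i : X ⟶ Y) {R R' : SimplicialObject M} (ψ : R ⟶ R') (n : ℕ) :
    HasLiftingProperty ∂Δ[n].ι (pullbackHom i ψ).π ↔
      HasLiftingProperty i (relMatchingMap ψ ⦋n⦌) := by
  rw [lifting_pullback_iff ∂Δ[n].ι (pullbackHom i ψ).isPullback (pullbackHom i ψ).π_fst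
    (pullbackHom i ψ).π_snd,
    lifting_pullback_iff i (IsPullback.of_hasPullback (matchingObjMap ψ ⦋n⦌) (matchingMap R' ⦋n⦌))
      (π := relMatchingMap ψ ⦋n⦌) (pullback.lift_fst _ _ _) (pullback.lift_snd _ _ _)]
  change (∀ (t : (∂Δ[n] : SSet.{v}) ⟶ homComplex Y R) (x : Δ[n] ⟶ homComplex X R)
    (z : Δ[n] ⟶ homComplex Y R'), t ≫ homComplexPrecomp i R = ∂Δ[n].ι ≫ x →
      t ≫ homComplexMap Y ψ = ∂Δ[n].ι ≫ z →
      x ≫ homComplexMap X ψ = z ≫ homComplexPrecomp i R' →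
      ∃ l : Δ[n] ⟶ homComplex Y R, ∂Δ[n].ι ≫ l = t ∧ l ≫ homComplexPrecomp i R = x ∧
        l ≫ homComplexMap Y ψ = z) ↔ _
  constructor
  · intro h x t z h₁ h₂ h₃
    obtain ⟨l, hl₁, hl₂, hl₃⟩ := h (toBoundary t) (homComplexSimplex x) (homComplexSimplex z)
      (by rw [toBoundary_precomp, boundary_ι_homComplexSimplex, h₁])
      (by rw [toBoundary_map, boundary_ι_homComplexSimplex, h₃])
      (by rw [homComplexSimplex_map, homComplexSimplex_precomp, h₂])
    obtain ⟨l, rfl⟩ := homComplexSimplex_surjective l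
    rw [boundary_ι_homComplexSimplex] at hl₁
    rw [homComplexSimplex_precomp] at hl₂
    rw [homComplexSimplex_map] at hl₃
    exact ⟨l, homComplexSimplex_injective hl₂, toBoundary_injective hl₁,
      homComplexSimplex_injective hl₃⟩
  · intro h t x z h₁ h₂ h₃
    obtain ⟨t, rfl⟩ := toBoundary_surjective t
    obtain ⟨x, rfl⟩ := homComplexSimplex_surjective x
    obtain ⟨z, rfl⟩ := homComplexSimplex_surjective z
    rw [toBoundary_precomp, boundary_ι_homComplexSimplex] at h₁
    rw [toBoundary_map, boundary_ι_homComplexSimplex] at h₂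
    rw [homComplexSimplex_map, homComplexSimplex_precomp] at h₃
    obtain ⟨l, hl₁, hl₂, hl₃⟩ := h x t z (toBoundary_injective h₁).symm
      (homComplexSimplex_injective h₃) (toBoundary_injective h₂)
    refine ⟨homComplexSimplex l, ?_, ?_, ?_⟩
    · rw [boundary_ι_homComplexSimplex, hl₂]
    · rw [homComplexSimplex_precomp, hl₁]
    · rw [homComplexSimplex_map, hl₃]

lemma isIso_relMatchingMap_fst {R R' : SimplicialObject M} (ψ : R ⟶ R') (hR' : IsTerminal R')
    (n : ℕ) : IsIso (pullback.fst (matchingObjMap ψ ⦋n⦌) (matchingMap R' ⦋n⦌)) := by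
  have h : ∀ k, Nonempty (IsTerminal (R'.obj k)) := fun k =>
    ⟨hR'.isTerminalObj ((evaluation _ _).obj k)⟩
  have hm : IsIso (matchingMap R' ⦋n⦌) := by
    refine ⟨⟨(h _).some.from _, (h _).some.hom_ext _ _, ?_⟩⟩
    apply limit.hom_ext
    exact fun m => (h _).some.hom_ext _ _
  infer_instance

variable [HasColimits M]

lemma relFib_iff (L : MorphismProperty M) {R R' : SimplicialObject M} (ψ : R ⟶ R') :
    relFib L ψ ↔ ∀ n : ℕ, L.rlp (relMatchingMap ψ ⦋n⦌) := by
  simp only [relFib_iff_boundary, boundary_lifting_iff]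
  exact ⟨fun h n _ _ i hi => h i hi n, fun h _ _ i hi n => h n i hi⟩

lemma relFib_from_iff (L : MorphismProperty M) {R R' : SimplicialObject M} (ψ : R ⟶ R')
    (hR' : IsTerminal R') :
    relFib L ψ ↔ ∀ n : SimplexCategory, L.rlp (matchingMap R n) := by
  rw [relFib_iff]
  have key : ∀ n : ℕ, L.rlp (relMatchingMap ψ ⦋n⦌) ↔ L.rlp (matchingMap R ⦋n⦌) := fun n => by
    have := isIso_relMatchingMap_fst ψ hR' n
    have e : relMatchingMap ψ ⦋n⦌ ≫ pullback.fst _ _ = matchingMap R ⦋n⦌ := pullback.lift_fst _ _ _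
    rw [← e, MorphismProperty.cancel_right_of_respectsIso L.rlp]
  simp only [key]
  exact ⟨fun h n => by induction n using SimplexCategory.rec; exact h _, fun h n => h _⟩

end

end Colocal

namespace Colocal

open Simplicial

/-! ## Relative Reedy fibrations that are levelwise weak equivalences -/

/-- `A` is built from the empty simplicial set by attaching its nondegenerate simplices, all of
dimension less than `n`. -/
lemma hasLiftingProperty_initial_to {A : SSet.{v}} {n : ℕ} [A.HasDimensionLT n] {E B : SSet.{v}}
    (p : E ⟶ B) (hp : ∀ k < n, HasLiftingProperty ∂Δ[k].ι p) :
    HasLiftingProperty (initial.to A) p := by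
  have : Mono (initial.to A) := MorphismProperty.monomorphisms.infer_property _
  let I : MorphismProperty SSet.{v} := .ofHoms fun k : Fin n => ∂Δ[k.1].ι
  have hI : I.rlp p := by
    rintro _ _ _ ⟨k⟩
    exact hp k.1 k.2
  exact MorphismProperty.transfiniteCompositionsOfShape_pushouts_coproducts_le_llp_rlp.{v} I ℕ _
    ⟨(SSet.relativeCellComplexOfMono (initial.to A)).transfiniteCompositionOfShape' fun c =>
      .mk (⟨c.j, A.dim_lt_of_nonDegenerate ⟨_, c.k.nonDegenerate⟩ n⟩ : Fin n)⟩ _ hI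

section

variable {M : Type u} [Category.{v} M] [HasLimits M]

/-- The matching object classifies maps out of `∂Δ[n]`, which has cells of dimension less than `n`
only. -/
lemma hasLiftingProperty_matchingObjMap {X Y : M} (i : X ⟶ Y) {R R' : SimplicialObject M}
    (ψ : R ⟶ R') (n : ℕ) (h : ∀ k < n, HasLiftingProperty i (relMatchingMap ψ ⦋k⦌)) :
    HasLiftingProperty i (matchingObjMap ψ ⦋n⦌) := by
  have := hasLiftingProperty_initial_to (A := (∂Δ[n] : SSet.{v})) (n := n) (pullbackHom i ψ).π
    fun k hk => (boundary_lifting_iff i ψ k).2 (h k hk)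
  rw [lifting_pullback_iff _ (pullbackHom i ψ).isPullback (pullbackHom i ψ).π_fst
    (pullbackHom i ψ).π_snd] at this
  replace this : ∀ (x : (∂Δ[n] : SSet.{v}) ⟶ homComplex X R)
    (z : (∂Δ[n] : SSet.{v}) ⟶ homComplex Y R'),
      x ≫ homComplexMap X ψ = z ≫ homComplexPrecomp i R' →
      ∃ l : (∂Δ[n] : SSet.{v}) ⟶ homComplex Y R, l ≫ homComplexPrecomp i R = x ∧
        l ≫ homComplexMap Y ψ = z := fun x z h => by
    obtain ⟨l, -, h₁, h₂⟩ := this (initial.to _) x z (initialIsInitial.hom_ext _ _)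
      (initialIsInitial.hom_ext _ _) h
    exact ⟨l, h₁, h₂⟩
  refine ⟨fun {x z} s => ?_⟩
  obtain ⟨l, h₁, h₂⟩ := this (toBoundary x) (toBoundary z) (by
    rw [toBoundary_map, toBoundary_precomp, s.w])
  obtain ⟨l, rfl⟩ := toBoundary_surjective l
  rw [toBoundary_precomp] at h₁
  rw [toBoundary_map] at h₂
  exact ⟨⟨{ l := l, fac_left := toBoundary_injective h₁, fac_right := toBoundary_injective h₂ }⟩⟩

variable [HasColimits M] [ModelCategory M]

/-- A levelwise weak equivalence of simplicial objects. -/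
def levelwiseWeq (M : Type u) [Category.{v} M] [ModelCategory M] :
    MorphismProperty (SimplicialObject M) :=
  fun _ _ ψ => ∀ n, weakEquivalences M (ψ.app n)

/-- By induction the relative matching maps below `n` are trivial fibrations, hence so are the map
of matching objects and its base change `pullback.snd`. The latter factors `ψ n` through the
relative matching map, and two-out-of-three applies. -/
lemma relFib_cofibrations {R R' : SimplicialObject M} {ψ : R ⟶ R'}
    (h : relFib (trivialCofibrations M) ψ) (hw : levelwiseWeq M ψ) :
    relFib (cofibrations M) ψ := by
  rw [relFib_iff] at h ⊢
  rw [MorphismProperty.rlp_eq_of_wfs (trivialCofibrations M) (fibrations M)] at h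
  rw [MorphismProperty.rlp_eq_of_wfs (cofibrations M) (trivialFibrations M)]
  intro n
  induction n using Nat.strong_induction_on with | _ n ih =>
  have h₁ : trivialFibrations M (matchingObjMap ψ ⦋n⦌) := by
    rw [← MorphismProperty.rlp_eq_of_wfs (cofibrations M) (trivialFibrations M)] at ih ⊢
    exact fun _ _ i hi => hasLiftingProperty_matchingObjMap i ψ n fun k hk => ih k hk _ hi
  have h₂ : trivialFibrations M (pullback.snd (matchingObjMap ψ ⦋n⦌) (matchingMap R' ⦋n⦌)) := by
    rw [← MorphismProperty.rlp_eq_of_wfs (cofibrations M) (trivialFibrations M)] at h₁ ⊢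
    exact MorphismProperty.pullback_snd _ _ h₁
  refine ⟨h n, ?_⟩
  refine (weakEquivalences M).of_postcomp _ (pullback.snd (matchingObjMap ψ ⦋n⦌)
    (matchingMap R' ⦋n⦌)) h₂.2 ?_
  rw [relMatchingMap, pullback.lift_snd]
  exact hw _

lemma sSetWeakEquivalence_homComplexMap {Z : M} (hZ : cofibrations M (initial.to Z))
    {R R' : SimplicialObject M} {ψ : R ⟶ R'}
    (h : relFib (trivialCofibrations M) ψ) (hw : levelwiseWeq M ψ) :
    SSetWeakEquivalence (homComplexMap Z ψ) :=
  .of_rlp _ (rlp_homComplexMap hZ (relFib_cofibrations h hw))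

end

end Colocal

namespace Colocal

open Simplicial

/-! ## Levels of the Leibniz tensors -/

section

variable {M : Type u} [Category.{v} M]

/-- Lifts are chosen one element at a time, keeping the prescribed ones on the image of the
injection `j`. -/
lemma hasLiftingProperty_coyoneda_π {X Y E B : M} (i : X ⟶ Y) (p : E ⟶ B)
    [HasLiftingProperty i p] {S S' : Type v} (j : S ⟶ S') (hj : Function.Injective j)
    (sq : (coyoneda (C := M)).PullbackObjObj i p) : HasLiftingProperty j sq.π := by
  rw [lifting_pullback_iff j sq.isPullback sq.π_fst sq.π_snd]
  intro t x z h₁ h₂ h₃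
  have hex : ∀ s' : S', ∃ l : Y ⟶ E, i ≫ l = x s' ∧ l ≫ p = z s' ∧ ∀ s, j s = s' → l = t s := by
    intro s'
    by_cases hs : ∃ s, j s = s'
    · obtain ⟨s, rfl⟩ := hs
      exact ⟨t s, ConcreteCategory.congr_hom h₁ s, ConcreteCategory.congr_hom h₂ s,
        fun s' h => by rw [hj h]⟩
    · have s : CommSq (x s' : X ⟶ E) i p (z s') := ⟨ConcreteCategory.congr_hom h₃ s'⟩
      exact ⟨s.lift, s.fac_left, s.fac_right, fun s h => (hs ⟨s, h⟩).elim⟩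
  choose l hl using hex
  refine ⟨↾l, ?_, ?_, ?_⟩
  · ext s
    exact (hl _).2.2 s rfl
  · ext s'
    exact (hl s').1
  · ext s'
    exact (hl s').2.1

variable [HasColimits M]

/-- The Leibniz tensor in degree `n`. -/
noncomputable def cornerApp {X Y : M} (i : X ⟶ Y) {A B : SSet.{v}} (j : A ⟶ B)
    (n : SimplexCategoryᵒᵖ) : (sigmaConst.{v} : M ⥤ Type v ⥤ M).PushoutObjObj i (j.app n) where
  pt := (Functor.PushoutObjObj.ofHasPushout (tensor M) i j).pt.obj n
  inl := (Functor.PushoutObjObj.ofHasPushout (tensor M) i j).inl.app n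
  inr := (Functor.PushoutObjObj.ofHasPushout (tensor M) i j).inr.app n
  isPushout := (Functor.PushoutObjObj.ofHasPushout (tensor M) i j).isPushout.map
    ((evaluation _ _).obj n)
  ι := (corner i j).app n
  inl_ι := congr_app (Functor.PushoutObjObj.ofHasPushout (tensor M) i j).inl_ι n
  inr_ι := congr_app (Functor.PushoutObjObj.ofHasPushout (tensor M) i j).inr_ι n

lemma isIso_corner_app {X Y : M} (i : X ⟶ Y) {A B : SSet.{v}} (j : A ⟶ B)
    (n : SimplexCategoryᵒᵖ) [IsIso (j.app n)] : IsIso ((corner i j).app n) := by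
  have h₁ : IsIso (cornerApp i j n).inl :=
    (MorphismProperty.isomorphisms M).of_isPushout (cornerApp i j n).isPushout
      (inferInstance : IsIso (((sigmaConst.{v} : M ⥤ Type v ⥤ M).obj X).map (j.app n)))
  have h₂ : (cornerApp i j n).inl ≫ (corner i j).app n = _ := (cornerApp i j n).inl_ι
  have h₃ : IsIso (((sigmaConst.{v} : M ⥤ Type v ⥤ M).obj Y).map (j.app n)) := inferInstance
  exact @IsIso.of_isIso_fac_left _ _ _ _ _ _ _ _ h₁ h₃ h₂

/-- The map out of a tensor which corresponds to a map to `M(E, R•)`. -/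
noncomputable def tensorHom {E : M} {A : SSet.{v}} {R : SimplicialObject M}
    (f : A ⟶ homComplex E R) : ((tensor M).obj E).obj A ⟶ R :=
  (tensorAdj M).homEquiv.symm f

section

variable {E E' : M} {A A' : SSet.{v}} {R R' : SimplicialObject M}

lemma tensorHom_injective {f f' : A ⟶ homComplex E R} (h : tensorHom f = tensorHom f') : f = f' :=
  (tensorAdj M).homEquiv.symm.injective h

lemma tensorHom_surjective (k : ((tensor M).obj E).obj A ⟶ R) :
    ∃ f : A ⟶ homComplex E R, tensorHom f = k :=
  (tensorAdj M).homEquiv.symm.surjective k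

lemma tensor_map_app_tensorHom (e : E' ⟶ E) (f : A ⟶ homComplex E R) :
    ((tensor M).map e).app A ≫ tensorHom f = tensorHom (f ≫ homComplexPrecomp e R) :=
  ((tensorAdj M).homEquiv_symm_naturality_one e f).symm

lemma tensor_obj_map_tensorHom (j : A' ⟶ A) (f : A ⟶ homComplex E R) :
    ((tensor M).obj E).map j ≫ tensorHom f = tensorHom (j ≫ f) :=
  ((tensorAdj M).homEquiv_symm_naturality_two j f).symm

lemma tensorHom_comp (f : A ⟶ homComplex E R) (ψ : R ⟶ R') :
    tensorHom f ≫ ψ = tensorHom (f ≫ homComplexMap E ψ) :=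
  ((tensorAdj M).homEquiv_symm_naturality_three ψ f).symm

lemma ι_tensorHom_app (f : A ⟶ homComplex E R) (n : SimplexCategoryᵒᵖ) (s : A.obj n) :
    Sigma.ι (fun _ : A.obj n => E) s ≫ (tensorHom f).app n = f.app n s := by
  obtain ⟨k, rfl⟩ := (tensorAdj M).homEquiv.surjective f
  have h : tensorHom ((tensorAdj M).homEquiv k) = k := Equiv.symm_apply_apply _ _
  rw [h]
  rfl

end

variable [ModelCategory M]

/-- By adjunction, lifting against a fibration `p` becomes a lifting problem for sets along the
injection `j.app n`. -/
lemma trivialCofibrations_corner_app {X Y : M} {i : X ⟶ Y} (hi : trivialCofibrations M i)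
    {A B : SSet.{v}} (j : A ⟶ B) [Mono j] (n : SimplexCategoryᵒᵖ) :
    trivialCofibrations M ((corner i j).app n) := by
  rw [← MorphismProperty.llp_eq_of_wfs (trivialCofibrations M) (fibrations M)]
  intro E P p hp
  have : HasLiftingProperty i p := by
    rw [← MorphismProperty.llp_eq_of_wfs (trivialCofibrations M) (fibrations M)] at hi
    exact hi _ hp
  refine ((sigmaConstAdjParam M).hasLiftingProperty_iff (cornerApp i j n)
    (.ofHasPullback coyoneda i p)).2 (hasLiftingProperty_coyoneda_π i p _ ?_ _)
  rw [← CategoryTheory.mono_iff_injective]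
  infer_instance

end

end Colocal

namespace Colocal

open Simplicial

/-! ## Attaching maps of `M` along boundaries -/

section

variable {M : Type u} [Category.{v} M]

lemma ι_sigmaConst_obj_map [HasColimits M] (E : M) {S S' : Type v} (j : S ⟶ S') (s : S) :
    Sigma.ι (fun _ : S => E) s ≫ (sigmaConst.obj E).map j = Sigma.ι (fun _ : S' => E) (j s) := by
  simp

variable [HasLimits M]

lemma isIso_matchingObjMap {R R' : SimplicialObject M} (ψ : R ⟶ R') (n : ℕ)
    (h : ∀ k < n, IsIso (ψ.app (op ⦋k⦌))) : IsIso (matchingObjMap ψ ⦋n⦌) := by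
  have : IsIso (Functor.whiskerLeft
      (ObjectProperty.ι _ ⋙ Over.forget (X := (⦋n⦌ : SimplexCategory))).op ψ :
        matchingDiagram R ⦋n⦌ ⟶ matchingDiagram R' ⦋n⦌) := by
    rw [NatTrans.isIso_iff_isIso_app]
    intro m
    change IsIso (ψ.app (op m.unop.obj.left))
    have hm := m.unop.property.1
    have hlt : m.unop.obj.left.len < n := by
      refine lt_of_le_of_ne (SimplexCategory.len_le_of_mono m.unop.obj.hom) fun he => ?_
      exact m.unop.property.2 ((SimplexCategory.isIso_iff_of_mono m.unop.obj.hom).2 he)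
    have := h _ hlt
    rwa [SimplexCategory.mk_len] at this
  have key : ∀ {F G : (ProperFace ⦋n⦌)ᵒᵖ ⥤ M} (α : F ⟶ G) [IsIso α], IsIso (limMap α) :=
    fun {_ _} α _ => Functor.map_isIso lim α
  exact key _

variable [HasColimits M]

/-- Pushing out along the Leibniz tensor of `e` with `∂Δ[n] ⟶ Δ[n]` replaces `R n` by `E`: in degree
`n` the only simplex outside the boundary is the identity, so a single copy of `E` is glued in along
`R n`. -/
lemma exists_attach {R B : SimplicialObject M} (p : R ⟶ B) (n : ℕ) {E : M} (e : R _⦋n⦌ ⟶ E)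
    (g : E ⟶ pullback (matchingObjMap p ⦋n⦌) (matchingMap B ⦋n⦌))
    (heg : e ≫ g = relMatchingMap p ⦋n⦌) :
    ∃ (R' : SimplicialObject M) (s : R ⟶ R') (p' : R' ⟶ B) (ε : E ⟶ R' _⦋n⦌), s ≫ p' = p ∧
      (∃ t κ, IsPushout t (corner e (SSet.boundary.{v} n).ι) s κ) ∧ IsIso ε ∧
      ε ≫ matchingMap R' ⦋n⦌ = g ≫ pullback.fst _ _ ≫ matchingObjMap s ⦋n⦌ ∧
      ε ≫ p'.app _ = g ≫ pullback.snd _ _ := by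
  have hfst : e ≫ g ≫ pullback.fst _ _ = matchingMap R ⦋n⦌ := by
    rw [reassoc_of% heg]; exact pullback.lift_fst _ _ _
  have hsnd : e ≫ g ≫ pullback.snd _ _ = p.app _ := by
    rw [reassoc_of% heg]; exact pullback.lift_snd _ _ _
  let ι : (∂Δ[n] : SSet.{v}) ⟶ Δ[n] := (SSet.boundary.{v} n).ι
  let c := Functor.PushoutObjObj.ofHasPushout (tensor M) e ι
  let a : (∂Δ[n] : SSet.{v}) ⟶ homComplex E R := toBoundary (g ≫ pullback.fst _ _)
  have ha : a ≫ homComplexPrecomp e R = ι ≫ homComplexSimplex (𝟙 (R _⦋n⦌)) := by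
    rw [toBoundary_precomp, hfst, boundary_ι_homComplexSimplex, Category.id_comp]
  let t : c.pt ⟶ R := c.isPushout.desc (tensorHom a) (tensorHom (homComplexSimplex (𝟙 (R _⦋n⦌))))
    (by rw [tensor_map_app_tensorHom, tensor_obj_map_tensorHom, ha])
  have ht₁ : c.inl ≫ t = tensorHom a := c.isPushout.inl_desc _ _ _
  have ht₂ : c.inr ≫ t = tensorHom (homComplexSimplex (𝟙 (R _⦋n⦌))) := c.isPushout.inr_desc _ _ _
  let b : ((tensor M).obj E).obj Δ[n] ⟶ B := tensorHom (homComplexSimplex (g ≫ pullback.snd _ _))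
  have htb : t ≫ p = corner e ι ≫ b := by
    apply c.hom_ext
    · rw [reassoc_of% ht₁, tensorHom_comp, toBoundary_map, Category.assoc, pullback.condition]
      refine Eq.trans ?_ (c.inl_ι_assoc b).symm
      rw [tensor_obj_map_tensorHom, boundary_ι_homComplexSimplex, Category.assoc]
    · rw [reassoc_of% ht₂, tensorHom_comp, homComplexSimplex_map, Category.id_comp]
      refine Eq.trans ?_ (c.inr_ι_assoc b).symm
      rw [tensor_map_app_tensorHom, homComplexSimplex_precomp, hsnd]
  have sq := IsPushout.of_hasPushout t (corner e ι)
  generalize pushout t (corner e ι) = R', pushout.inl t (corner e ι) = s,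
    pushout.inr t (corner e ι) = κ at sq
  let p' : R' ⟶ B := sq.desc p b htb
  -- `ε` is the component of `κ` at the identity simplex.
  obtain ⟨ε, hε⟩ : ∃ ε : E ⟶ R' _⦋n⦌, tensorHom (homComplexSimplex ε) = κ := by
    obtain ⟨f, rfl⟩ := tensorHom_surjective κ
    obtain ⟨ε, rfl⟩ := homComplexSimplex_surjective f
    exact ⟨ε, rfl⟩
  have h₁ : ε ≫ matchingMap R' ⦋n⦌ = g ≫ pullback.fst _ _ ≫ matchingObjMap s ⦋n⦌ := by
    apply toBoundary_injective
    apply tensorHom_injective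
    rw [← boundary_ι_homComplexSimplex, ← tensor_obj_map_tensorHom, hε, ← Category.assoc g,
      ← toBoundary_map, ← tensorHom_comp]
    refine (c.inl_ι_assoc κ).symm.trans ((congrArg (c.inl ≫ ·) sq.w.symm).trans ?_)
    rw [reassoc_of% ht₁]
  have h₂ : e ≫ ε = s.app _ := by
    apply homComplexSimplex_injective
    apply tensorHom_injective
    rw [← homComplexSimplex_precomp, ← tensor_map_app_tensorHom, hε]
    refine (c.inr_ι_assoc κ).symm.trans ((congrArg (c.inr ≫ ·) sq.w.symm).trans ?_)
    rw [reassoc_of% ht₂, tensorHom_comp, homComplexSimplex_map, Category.id_comp]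
  have h₃ : ε ≫ p'.app _ = g ≫ pullback.snd _ _ := by
    apply homComplexSimplex_injective
    apply tensorHom_injective
    rw [← homComplexSimplex_map, ← tensorHom_comp, hε]
    exact sq.inr_desc _ _ _
  refine ⟨R', s, p', ε, sq.inl_desc _ _ _, ⟨t, κ, sq⟩, ?_, h₁, h₃⟩
  classical
  let D : Type v := (Δ[n] : SSet.{v}).obj (op ⦋n⦌)
  -- These components define the inverse of `ε` on the glued part: boundary simplices act through `R
  -- n` and then `e`, and the identity simplex acts as the identity of `E`.
  let d₀ : D → (E ⟶ E) := fun σ =>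
    if h : σ ∈ (SSet.boundary.{v} n).obj (op ⦋n⦌) then a.app (op ⦋n⦌) ⟨σ, h⟩ ≫ e else 𝟙 E
  let d : (∐ fun _ : D => E) ⟶ E := Sigma.desc d₀
  have hD : ∀ σ : D, σ ∉ (SSet.boundary.{v} n).obj (op ⦋n⦌) →
      σ = SSet.stdSimplex.objEquiv.symm (𝟙 ⦋n⦌) := fun σ hσ => by
    obtain ⟨σ, rfl⟩ := SSet.stdSimplex.objEquiv.symm.surjective σ
    congr 1
    have : Epi σ := SimplexCategory.epi_iff_surjective.2 (not_not.1 hσ)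
    exact SimplexCategory.eq_id_of_epi σ
  have hid : SSet.stdSimplex.objEquiv.symm (𝟙 ⦋n⦌) ∉ (SSet.boundary.{v} n).obj (op ⦋n⦌) :=
    fun h => h (SimplexCategory.epi_iff_surjective.1 (inferInstance : Epi (𝟙 ⦋n⦌)))
  have hd : ∀ σ : D, Sigma.ι (fun _ : D => E) σ ≫ d = d₀ σ := fun σ => Sigma.ι_desc _ _
  have hd₁ : ∀ (σ : D) (h : σ ∈ (SSet.boundary.{v} n).obj (op ⦋n⦌)),
      d₀ σ = a.app (op ⦋n⦌) ⟨σ, h⟩ ≫ e := fun σ h => dif_pos h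
  have hd₂ : ∀ σ : D, σ ∉ (SSet.boundary.{v} n).obj (op ⦋n⦌) → d₀ σ = 𝟙 E := fun σ h => dif_neg h
  have ha' : ∀ (σ : D) (h : σ ∈ (SSet.boundary.{v} n).obj (op ⦋n⦌)),
      e ≫ a.app (op ⦋n⦌) ⟨σ, h⟩ = R.map (SSet.stdSimplex.objEquiv σ).op := fun σ h =>
    (ConcreteCategory.congr_hom (congr_app ha (op ⦋n⦌)) ⟨σ, h⟩).trans (Category.id_comp _)
  have hs : a ≫ homComplexMap E s = ι ≫ homComplexSimplex ε := by
    rw [toBoundary_map, boundary_ι_homComplexSimplex, h₁, Category.assoc]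
  have hκ : ∀ σ : D, Sigma.ι (fun _ : D => E) σ ≫ κ.app (op ⦋n⦌) =
      ε ≫ R'.map (SSet.stdSimplex.objEquiv σ).op := fun σ => by
    rw [← hε]
    exact ι_tensorHom_app (homComplexSimplex ε) (op ⦋n⦌) σ
  have hc : t.app (op ⦋n⦌) ≫ e = (corner e ι).app (op ⦋n⦌) ≫ d := by
    apply (cornerApp e ι (op ⦋n⦌)).hom_ext
    · refine Sigma.hom_ext _ _ fun σ => ?_
      have e₁ : c.inl.app (op ⦋n⦌) ≫ t.app (op ⦋n⦌) = (tensorHom a).app (op ⦋n⦌) :=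
        congr_app ht₁ _
      have e₂ : c.inl.app (op ⦋n⦌) ≫ (corner e ι).app (op ⦋n⦌) =
        (sigmaConst.{v}.obj E).map (ι.app (op ⦋n⦌)) := congr_app c.inl_ι _
      refine (congrArg (Sigma.ι (fun _ => E) σ ≫ ·) ((Category.assoc _ _ _).symm.trans
        (congrArg (· ≫ e) e₁))).trans (Eq.trans ?_ (congrArg (Sigma.ι (fun _ => E) σ ≫ ·)
        ((Category.assoc _ _ _).symm.trans (congrArg (· ≫ d) e₂)).symm))
      refine (Category.assoc _ _ _).symm.trans ((congrArg (· ≫ e)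
        (ι_tensorHom_app a (op ⦋n⦌) σ)).trans ?_)
      refine Eq.trans ?_ (Category.assoc _ _ _)
      refine Eq.trans ?_ (congrArg (· ≫ d) (ι_sigmaConst_obj_map _ _ _).symm)
      exact ((hd _).trans (hd₁ _ σ.2)).symm
    · refine Sigma.hom_ext _ _ fun σ => ?_
      have e₁ : c.inr.app (op ⦋n⦌) ≫ t.app (op ⦋n⦌) =
          (tensorHom (homComplexSimplex (𝟙 (R _⦋n⦌)))).app (op ⦋n⦌) :=
        congr_app ht₂ _
      have e₂ : c.inr.app (op ⦋n⦌) ≫ (corner e ι).app (op ⦋n⦌) =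
        (sigmaConst.{v}.map e).app (Δ[n].obj (op ⦋n⦌)) := congr_app c.inr_ι _
      refine (congrArg (Sigma.ι (fun _ => R _⦋n⦌) σ ≫ ·) ((Category.assoc _ _ _).symm.trans
        (congrArg (· ≫ e) e₁))).trans (Eq.trans ?_ (congrArg (Sigma.ι (fun _ => R _⦋n⦌) σ ≫ ·)
        ((Category.assoc _ _ _).symm.trans (congrArg (· ≫ d) e₂)).symm))
      refine (Category.assoc _ _ _).symm.trans ((congrArg (· ≫ e)
        (ι_tensorHom_app (homComplexSimplex (𝟙 (R _⦋n⦌))) (op ⦋n⦌) σ)).trans ?_)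
      refine Eq.trans ?_ (Category.assoc _ _ _)
      refine Eq.trans ?_ (congrArg (· ≫ d) (Sigma.ι_map (fun _ => e) σ).symm)
      refine Eq.trans ?_ ((Category.assoc _ _ _).trans (congrArg (e ≫ ·) (hd σ))).symm
      refine (congrArg (· ≫ e) (Category.id_comp _)).trans ?_
      by_cases h : σ ∈ (SSet.boundary.{v} n).obj (op ⦋n⦌)
      · refine Eq.trans ?_ (congrArg (e ≫ ·) (hd₁ σ h).symm)
        exact (congrArg (· ≫ e) (ha' σ h).symm).trans (Category.assoc _ _ _)
      · refine Eq.trans ?_ (congrArg (e ≫ ·) (hd₂ σ h).symm)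
        obtain rfl := hD σ h
        exact (congrArg (· ≫ e) (R.map_id _)).trans
          ((Category.id_comp _).trans (Category.comp_id _).symm)
  have sqn := sq.map ((evaluation _ _).obj (op ⦋n⦌))
  let r : R' _⦋n⦌ ⟶ E := sqn.desc e d hc
  have hr₁ : s.app (op ⦋n⦌) ≫ r = e := sqn.inl_desc _ _ _
  have hr₂ : κ.app (op ⦋n⦌) ≫ r = d := sqn.inr_desc _ _ _
  have hεκ : Sigma.ι (fun _ : D => E) (SSet.stdSimplex.objEquiv.symm (𝟙 ⦋n⦌)) ≫
      κ.app (op ⦋n⦌) = ε := by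
    exact (hκ _).trans ((congrArg (ε ≫ ·) (R'.map_id _)).trans (Category.comp_id _))
  refine ⟨r, ?_, sqn.hom_ext ?_ ?_⟩
  · rw [← hεκ, Category.assoc, hr₂, hd, hd₂ _ hid]
  · refine (Category.assoc _ _ _).symm.trans ((congrArg (· ≫ ε) hr₁).trans ?_)
    exact h₂.trans (Category.comp_id _).symm
  · refine (Category.assoc _ _ _).symm.trans ((congrArg (· ≫ ε) hr₂).trans ?_)
    refine Eq.trans ?_ (Category.comp_id _).symm
    refine Sigma.hom_ext _ _ fun σ => ?_
    refine (Category.assoc _ _ _).symm.trans ((congrArg (· ≫ ε) (hd σ)).trans ?_)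
    by_cases h : σ ∈ (SSet.boundary.{v} n).obj (op ⦋n⦌)
    · refine Eq.trans ?_ (hκ σ).symm
      refine (congrArg (· ≫ ε) (hd₁ σ h)).trans ((Category.assoc _ _ _).trans
        ((congrArg (a.app (op ⦋n⦌) ⟨σ, h⟩ ≫ ·) h₂).trans ?_))
      exact ConcreteCategory.congr_hom (congr_app hs (op ⦋n⦌)) ⟨σ, h⟩
    · refine (congrArg (· ≫ ε) (hd₂ σ h)).trans ((Category.id_comp _).trans ?_)
      obtain rfl := hD σ h
      exact hεκ.symm

end

end Colocal

namespace Colocal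

open Simplicial

/-! ## Factorizations of maps of simplicial objects -/

lemma map_of_ge {C : Type*} [Category C] (W : MorphismProperty C) [W.IsMultiplicative]
    (F : ℕ ⥤ C) (N : ℕ) (h : ∀ m, N ≤ m → W (F.map (homOfLE m.le_succ))) {i j : ℕ} (hi : N ≤ i)
    (f : i ⟶ j) : W (F.map f) := by
  obtain ⟨k, rfl⟩ := Nat.exists_eq_add_of_le (leOfHom f)
  induction k with
  | zero =>
    rw [Subsingleton.elim f (𝟙 i), F.map_id]
    exact W.id_mem _
  | succ k ih =>
    rw [Subsingleton.elim f (homOfLE (Nat.le_add_right i k) ≫ homOfLE (i + k).le_succ),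
      F.map_comp]
    exact W.comp_mem _ _ (ih _) (h _ (by lia))

section

variable {M : Type u} [Category.{v} M] [HasLimits M]

lemma matchingObjMap_comp {R R' R'' : SimplicialObject M} (f : R ⟶ R') (g : R' ⟶ R'')
    (n : SimplexCategory) :
    matchingObjMap (f ≫ g) n = matchingObjMap f n ≫ matchingObjMap g n := by
  apply limit.hom_ext
  intro m
  rw [matchingObjMap_π, Category.assoc, matchingObjMap_π]
  exact (Category.assoc _ _ _).symm.trans ((congrArg (· ≫ g.app _) (matchingObjMap_π f n m)).symm.trans
    (Category.assoc _ _ _))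

lemma relMatchingMap_fst {R R' : SimplicialObject M} (ψ : R ⟶ R') (n : SimplexCategory) :
    relMatchingMap ψ n ≫ pullback.fst _ _ = matchingMap R n :=
  pullback.lift_fst _ _ _

lemma relMatchingMap_snd {R R' : SimplicialObject M} (ψ : R ⟶ R') (n : SimplexCategory) :
    relMatchingMap ψ n ≫ pullback.snd _ _ = ψ.app (op n) :=
  pullback.lift_snd _ _ _

variable [ModelCategory M]

/-- Matching objects at `n` see only degrees below `n`, where `s` is invertible; so the relative
matching map of `p'` is `g` up to isomorphism. -/
lemma fibrations_relMatchingMap {R R' B : SimplicialObject M} {s : R ⟶ R'} {p : R ⟶ B}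
    {p' : R' ⟶ B} (hs : s ≫ p' = p) (n : ℕ) (hiso : ∀ k < n, IsIso (s.app (op ⦋k⦌)))
    {E : M} (ε : E ⟶ R' _⦋n⦌) [IsIso ε]
    (g : E ⟶ pullback (matchingObjMap p ⦋n⦌) (matchingMap B ⦋n⦌)) (hg : fibrations M g)
    (h₁ : ε ≫ matchingMap R' ⦋n⦌ = g ≫ pullback.fst _ _ ≫ matchingObjMap s ⦋n⦌)
    (h₂ : ε ≫ p'.app _ = g ≫ pullback.snd _ _) : fibrations M (relMatchingMap p' ⦋n⦌) := by
  have := isIso_matchingObjMap s n hiso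
  have hsp : matchingObjMap s ⦋n⦌ ≫ matchingObjMap p' ⦋n⦌ = matchingObjMap p ⦋n⦌ := by
    rw [← hs, matchingObjMap_comp]
  let q := pullback.map (matchingObjMap p ⦋n⦌) (matchingMap B ⦋n⦌) (matchingObjMap p' ⦋n⦌)
    (matchingMap B ⦋n⦌) (matchingObjMap s ⦋n⦌) (𝟙 _) (𝟙 _) (by simp [hsp]) (by simp)
  have hq : ε ≫ relMatchingMap p' ⦋n⦌ = g ≫ q := by
    apply pullback.hom_ext
    · rw [Category.assoc, Category.assoc, relMatchingMap, pullback.lift_fst, h₁, pullback.lift_fst]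
    · rw [Category.assoc, Category.assoc, relMatchingMap, pullback.lift_snd, h₂, pullback.lift_snd,
        Category.comp_id]
  have : IsIso q := inferInstance
  rw [← MorphismProperty.cancel_left_of_respectsIso (fibrations M) ε, hq,
    MorphismProperty.cancel_right_of_respectsIso (fibrations M)]
  exact hg

lemma fibrations_relMatchingMap_of_isIso {R R' B : SimplicialObject M} {s : R ⟶ R'} {p : R ⟶ B}
    {p' : R' ⟶ B} (hs : s ≫ p' = p) (n : ℕ) (hiso : ∀ k ≤ n, IsIso (s.app (op ⦋k⦌)))
    (h : fibrations M (relMatchingMap p ⦋n⦌)) : fibrations M (relMatchingMap p' ⦋n⦌) := by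
  have := hiso n le_rfl
  refine fibrations_relMatchingMap hs n (fun k hk => hiso k hk.le) (s.app (op ⦋n⦌)) _ h ?_ ?_
  · rw [← matchingMap_naturality, ← Category.assoc, relMatchingMap_fst]
  · rw [relMatchingMap_snd, ← hs, NatTrans.comp_app]

variable [HasColimits M]

/-- The relative matching map is factored as a trivial cofibration `d.i` followed by a fibration,
and `d.i` is attached. Every level of the new map is a pushout of a trivial cofibration, and below
`n` nothing changes because the boundary contains all those simplices. -/
lemma exists_step {B : SimplicialObject M} (n : ℕ) (X : Over B) :
    ∃ (X' : Over B) (s : X ⟶ X'), levelwiseWeq M s.left ∧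
      (∀ k < n, IsIso (s.left.app (op ⦋k⦌))) ∧ fibrations M (relMatchingMap X'.hom ⦋n⦌) := by
  let d := MorphismProperty.factorizationData (trivialCofibrations M) (fibrations M)
    (relMatchingMap X.hom ⦋n⦌)
  obtain ⟨R', s, p', ε, hs, ⟨t, κ, sq⟩, _, h₁, h₂⟩ := exists_attach X.hom n d.i d.p d.fac
  have hiso : ∀ k < n, IsIso (s.app (op ⦋k⦌)) := fun k hk => by
    have : IsIso ((SSet.boundary.{v} n).ι.app (op ⦋k⦌)) := by
      rw [CategoryTheory.isIso_iff_bijective]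
      exact ⟨Subtype.val_injective, fun x => ⟨⟨x, by
        rw [SSet.boundary_obj_eq_univ k n hk]; trivial⟩, rfl⟩⟩
    exact (MorphismProperty.isomorphisms M).of_isPushout
      (sq.map ((evaluation _ _).obj (op ⦋k⦌))) (isIso_corner_app _ _ _)
  refine ⟨Over.mk p', Over.homMk s hs, fun k => ?_, hiso,
    fibrations_relMatchingMap hs n hiso ε d.p d.hp h₁ h₂⟩
  have := MorphismProperty.of_isPushout (P := trivialCofibrations M)
    (sq.map ((evaluation _ _).obj k)) (trivialCofibrations_corner_app d.hi _ k)
  exact this.2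

/-- Every map of simplicial objects is a levelwise weak equivalence followed by a relative Reedy
fibration. -/
lemma exists_factorization {A B : SimplicialObject M} (φ : A ⟶ B) :
    ∃ (R : SimplicialObject M) (a : A ⟶ R) (p : R ⟶ B), a ≫ p = φ ∧ levelwiseWeq M a ∧
      relFib (trivialCofibrations M) p := by
  choose next s hw hiso hfib using fun n X => exists_step (B := B) n X
  -- The passage from stage `n` to stage `n + 1` repairs degree `n`; later steps leave it fixed, so
  -- degree `n` of the colimit is that of stage `n + 1`.
  let X : ℕ → Over B := fun n => Nat.rec (Over.mk φ) next n
  let F : ℕ ⥤ Over B := Functor.ofSequence (X := X) fun n => s n (X n)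
  let G : ℕ ⥤ SimplicialObject M := F ⋙ Over.forget B
  have hG : ∀ n, G.map (homOfLE n.le_succ) = (s n (X n)).left := fun n =>
    congrArg CommaMorphism.left (Functor.ofSequence_map_homOfLE_succ _ n)
  let c : Cocone G :=
    { pt := B
      ι := { app n := (F.obj n).hom, naturality n m f := by simp [G] } }
  have hconst : ∀ k n : ℕ, k ≤ n →
      (G ⋙ (evaluation _ _).obj (op ⦋k⦌)).IsEventuallyConstantFrom (n + 1) := fun k n hk j f => by
    refine map_of_ge (MorphismProperty.isomorphisms M) _ (n + 1) (fun m hm => ?_) le_rfl f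
    change IsIso ((G.map (homOfLE m.le_succ)).app _)
    rw [hG]
    exact hiso m _ k (by lia)
  have hι : ∀ k n : ℕ, k ≤ n → IsIso ((colimit.ι G (n + 1)).app (op ⦋k⦌)) := fun k n hk =>
    (hconst k n hk).isIso_ι_of_isColimit
      (isColimitOfPreserves ((evaluation _ _).obj (op ⦋k⦌)) (colimit.isColimit G))
  have hc : ∀ n, colimit.ι G n ≫ colimit.desc G c = (X n).hom := fun n => colimit.ι_desc _ _
  refine ⟨colimit G, colimit.ι G 0, colimit.desc G c, hc 0, fun k => ?_, ?_⟩
  · induction k using Opposite.rec with | _ k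
    induction k using SimplexCategory.rec with | _ k
    have := hι k k le_rfl
    rw [← colimit.w G (homOfLE (Nat.zero_le (k + 1)))]
    refine ((weakEquivalences M).cancel_right_of_respectsIso _ _).2 ?_
    refine map_of_ge (weakEquivalences M) (G ⋙ (evaluation _ _).obj (op ⦋k⦌)) 0 (fun m _ => ?_)
      le_rfl _
    change weakEquivalences M ((G.map (homOfLE m.le_succ)).app _)
    rw [hG]
    exact hw m _ _
  · rw [relFib_iff, MorphismProperty.rlp_eq_of_wfs (trivialCofibrations M) (fibrations M)]
    intro n
    exact fibrations_relMatchingMap_of_isIso (hc (n + 1)) n (fun k hk => hι k n hk)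
      (hfib n (X n))

end

end Colocal

namespace Colocal

open Simplicial

/-! ## Independence of the resolutions -/

section

variable {M : Type u} [Category.{v} M]

lemma homComplexMap_comp (Z : M) {R R' R'' : SimplicialObject M} (f : R ⟶ R') (g : R' ⟶ R'') :
    homComplexMap Z (f ≫ g) = homComplexMap Z f ≫ homComplexMap Z g :=
  Functor.whiskerRight_comp _ _ _

lemma homComplexMap_id (Z : M) (R : SimplicialObject M) :
    homComplexMap Z (𝟙 R) = 𝟙 _ :=
  Functor.whiskerRight_id _

variable [ModelCategory M]

lemma levelwiseWeq.comp {R R' R'' : SimplicialObject M} {f : R ⟶ R'} {g : R' ⟶ R''}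
    (hf : levelwiseWeq M f) (hg : levelwiseWeq M g) : levelwiseWeq M (f ≫ g) :=
  fun n => (weakEquivalences M).comp_mem _ _ (hf n) (hg n)

lemma levelwiseWeq.of_precomp {R R' R'' : SimplicialObject M} {f : R ⟶ R'} {g : R' ⟶ R''}
    (hf : levelwiseWeq M f) (hfg : levelwiseWeq M (f ≫ g)) : levelwiseWeq M g :=
  fun n => (weakEquivalences M).of_precomp _ _ (hf n) (hfg n)

lemma levelwiseWeq_const {A B : M} {f : A ⟶ B} (hf : weakEquivalences M f) :
    levelwiseWeq M ((SimplicialObject.const M).map f) :=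
  fun _ => hf

variable [HasLimits M] [HasColimits M]

lemma isReedyFibrant_iff (R : SimplicialObject M) :
    (modelClasses M).IsReedyFibrant R ↔ relFib (trivialCofibrations M) (terminal.from R) := by
  rw [relFib_from_iff _ _ terminalIsTerminal,
    MorphismProperty.rlp_eq_of_wfs (trivialCofibrations M) (fibrations M)]
  rfl

/-- A third resolution of `c` is constructed over the product of the given two. Its projections are
relative Reedy fibrations and levelwise weak equivalences, so M(Z, -) inverts them, and
two-out-of-three transfers the conclusion from `r` to `q`. -/
lemma sSetWeakEquivalence_of_zigzag {Z : M} (hZ : cofibrations M (initial.to Z))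
    {CA CB RA RB QA QB : SimplicialObject M} {c : CA ⟶ CB} {r : RA ⟶ RB} {q : QA ⟶ QB}
    {iA : CA ⟶ RA} {iB : CB ⟶ RB} {jA : CA ⟶ QA} {jB : CB ⟶ QB}
    (hiA : levelwiseWeq M iA) (hiB : levelwiseWeq M iB) (hjA : levelwiseWeq M jA)
    (hjB : levelwiseWeq M jB) (wi : iA ≫ r = c ≫ iB) (wj : jA ≫ q = c ≫ jB)
    (hRA : (modelClasses M).IsReedyFibrant RA) (hRB : (modelClasses M).IsReedyFibrant RB)
    (hQA : (modelClasses M).IsReedyFibrant QA) (hQB : (modelClasses M).IsReedyFibrant QB)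
    (h : SSetWeakEquivalence (homComplexMap Z r)) : SSetWeakEquivalence (homComplexMap Z q) := by
  rw [isReedyFibrant_iff] at hRA hRB hQA hQB
  let J := relFib (M := M) (trivialCofibrations M)
  have : J.IsMultiplicative := inferInstanceAs (corners _).rlp.IsMultiplicative
  have : J.IsStableUnderBaseChange := inferInstanceAs (corners _).rlp.IsStableUnderBaseChange
  have hfst : ∀ {R Q : SimplicialObject M}, J (terminal.from Q) → J (prod.fst : R ⨯ Q ⟶ R) :=
    fun h => J.of_isPullback (IsPullback.of_hasBinaryProduct' _ _).flip h
  have hsnd : ∀ {R Q : SimplicialObject M}, J (terminal.from R) → J (prod.snd : R ⨯ Q ⟶ Q) :=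
    fun h => J.of_isPullback (IsPullback.of_hasBinaryProduct' _ _) h
  obtain ⟨EB, aB, pB, hB, haB, hpB⟩ := exists_factorization (prod.lift iB jB)
  have wP : (c ≫ aB) ≫ pB = prod.lift iA jA ≫ prod.map r q := by
    rw [Category.assoc, hB]
    apply prod.hom_ext <;> simp [wi, wj]
  -- Factoring over the pullback makes `EA` map compatibly to `EB` and to both given domains.
  obtain ⟨EA, aA, pA, hA, haA, hpA⟩ := exists_factorization (pullback.lift _ _ wP)
  have hP : J (pullback.snd pB (prod.map r q)) := J.pullback_snd _ _ hpB
  have hA' : aA ≫ pA ≫ pullback.snd _ _ = prod.lift iA jA := by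
    rw [reassoc_of% hA, pullback.lift_snd]
  have weq {E R : SimplicialObject M} {p : E ⟶ R} {C : SimplicialObject M} {a : C ⟶ E}
      (hp : J p) (ha : levelwiseWeq M a) (hap : levelwiseWeq M (a ≫ p)) :
      SSetWeakEquivalence (homComplexMap Z p) :=
    sSetWeakEquivalence_homComplexMap hZ hp (ha.of_precomp hap)
  have hA₁ : SSetWeakEquivalence (homComplexMap Z (pA ≫ pullback.snd _ _ ≫ prod.fst)) :=
    weq (J.comp_mem _ _ hpA (J.comp_mem _ _ hP (hfst hQA))) haA (by
      rwa [reassoc_of% hA', prod.lift_fst])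
  have hA₂ : SSetWeakEquivalence (homComplexMap Z (pA ≫ pullback.snd _ _ ≫ prod.snd)) :=
    weq (J.comp_mem _ _ hpA (J.comp_mem _ _ hP (hsnd hRA))) haA (by
      rwa [reassoc_of% hA', prod.lift_snd])
  have hB₁ : SSetWeakEquivalence (homComplexMap Z (pB ≫ prod.fst)) :=
    weq (J.comp_mem _ _ hpB (hfst hQB)) haB (by rwa [reassoc_of% hB, prod.lift_fst])
  have hB₂ : SSetWeakEquivalence (homComplexMap Z (pB ≫ prod.snd)) :=
    weq (J.comp_mem _ _ hpB (hsnd hRB)) haB (by rwa [reassoc_of% hB, prod.lift_snd])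
  have w₁ : (pA ≫ pullback.fst _ _) ≫ pB ≫ prod.fst = (pA ≫ pullback.snd _ _ ≫ prod.fst) ≫ r := by
    simp [pullback.condition_assoc]
  have w₂ : (pA ≫ pullback.fst _ _) ≫ pB ≫ prod.snd = (pA ≫ pullback.snd _ _ ≫ prod.snd) ≫ q := by
    simp [pullback.condition_assoc]
  have hE : SSetWeakEquivalence (homComplexMap Z (pA ≫ pullback.fst pB (prod.map r q))) := by
    refine .of_postcomp hB₁ ?_
    rw [← homComplexMap_comp, w₁, homComplexMap_comp]
    exact hA₁.comp h
  refine .of_precomp hA₂ ?_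
  rw [← homComplexMap_comp, ← w₂, homComplexMap_comp]
  exact hE.comp hB₂

/-- As a map of simplicial objects, `φ` is resolved by `𝟙 Q` (through `φ` itself on the domain) and
also by `φ`. -/
lemma sSetWeakEquivalence_of_levelwiseWeq {Z : M} (hZ : cofibrations M (initial.to Z))
    {R Q : SimplicialObject M} {φ : R ⟶ Q} (hφ : levelwiseWeq M φ)
    (hR : (modelClasses M).IsReedyFibrant R) (hQ : (modelClasses M).IsReedyFibrant Q) :
    SSetWeakEquivalence (homComplexMap Z φ) := by
  have hid : ∀ R : SimplicialObject M, levelwiseWeq M (𝟙 R) := fun R n =>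
    (weakEquivalences M).id_mem _
  refine sSetWeakEquivalence_of_zigzag hZ (c := φ) (r := 𝟙 Q) (iA := φ) (iB := 𝟙 Q) (jA := 𝟙 R)
    (jB := 𝟙 Q) hφ (hid _) (hid _) (hid _) rfl (by simp) hQ hQ hR hQ ?_
  rw [homComplexMap_id]
  exact .of_isIso _

lemma exists_resolution {A B : M} (f : A ⟶ B) :
    ∃ (RA RB : SimplicialObject M) (iA : (SimplicialObject.const M).obj A ⟶ RA)
      (iB : (SimplicialObject.const M).obj B ⟶ RB) (r : RA ⟶ RB),
      (modelClasses M).IsSimplicialResolution iA ∧ (modelClasses M).IsSimplicialResolution iB ∧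
      iA ≫ r = (SimplicialObject.const M).map f ≫ iB := by
  obtain ⟨RB, iB, pB, -, hiB, hpB⟩ :=
    exists_factorization (terminal.from ((SimplicialObject.const M).obj B))
  obtain ⟨RA, iA, r, hr, hiA, hpA⟩ := exists_factorization ((SimplicialObject.const M).map f ≫ iB)
  obtain rfl := terminalIsTerminal.hom_ext pB (terminal.from _)
  refine ⟨RA, RB, iA, iB, r, ⟨hiA, ?_⟩, ⟨hiB, (isReedyFibrant_iff RB).2 hpB⟩, hr⟩
  rw [isReedyFibrant_iff, ← terminalIsTerminal.hom_ext (r ≫ terminal.from RB) (terminal.from RA)]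
  exact (corners _).rlp.comp_mem _ _ hpA hpB

/-- `P` and `Q` may resolve different maps weakly equivalent to `f`; both are compared with a
resolution of `f` itself, augmented through the comparison maps `a` and `b`. -/
lemma Classes.MapResolution.sSetWeakEquivalence {Z : M} (hZ : cofibrations M (initial.to Z))
    {A B : M} {f : A ⟶ B} (P Q : (modelClasses M).MapResolution f)
    (h : SSetWeakEquivalence (homComplexMap Z P.res)) :
    SSetWeakEquivalence (homComplexMap Z Q.res) := by
  obtain ⟨RA, RB, iA, iB, r, hA, hB, hr⟩ := exists_resolution f
  have key : ∀ P : (modelClasses M).MapResolution f,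
      ((SimplicialObject.const M).map P.a ≫ iA) ≫ r = (SimplicialObject.const M).map P.f' ≫
        ((SimplicialObject.const M).map P.b ≫ iB) := fun P => by
    rw [Category.assoc, hr, ← Category.assoc, ← Category.assoc, ← Functor.map_comp,
      ← Functor.map_comp, P.comm]
  have h' : SSetWeakEquivalence (homComplexMap Z r) :=
    sSetWeakEquivalence_of_zigzag hZ P.resolution_iA.weq P.resolution_iB.weq
      ((levelwiseWeq_const P.weq_a).comp hA.weq) ((levelwiseWeq_const P.weq_b).comp hB.weq)
      P.comm_res (key P) P.resolution_iA.reedyFibrant P.resolution_iB.reedyFibrant hA.reedyFibrant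
      hB.reedyFibrant h
  exact sSetWeakEquivalence_of_zigzag hZ
      ((levelwiseWeq_const Q.weq_a).comp hA.weq) ((levelwiseWeq_const Q.weq_b).comp hB.weq)
      Q.resolution_iA.weq Q.resolution_iB.weq
      (key Q) Q.comm_res hA.reedyFibrant hB.reedyFibrant Q.resolution_iA.reedyFibrant
      Q.resolution_iB.reedyFibrant h'

end

end Colocal

namespace Colocal

open Simplicial

/-! ## Colocal equivalences between colocal objects -/

section

variable {M : Type u} [Category.{v} M] [ModelCategory M]

/-- The idempotent `p ≫ σ` fixes `f ≫ σ`, hence is a weak equivalence by two-out-of-three, and `p`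
is a retract of it. -/
lemma weakEquivalences_of_section {X Y A : M} {f : X ⟶ Y} {σ : Y ⟶ A} {p : A ⟶ Y}
    (hσ : σ ≫ p = 𝟙 Y) (h : weakEquivalences M (f ≫ σ)) : weakEquivalences M f := by
  have he : weakEquivalences M (p ≫ σ) :=
    (weakEquivalences M).of_precomp (f ≫ σ) (p ≫ σ) h (by
      rw [Category.assoc, reassoc_of% hσ]; exact h)
  have hp : weakEquivalences M p := (weakEquivalences M).of_retract
    { i := Arrow.homMk (𝟙 A) σ (by simp)
      r := Arrow.homMk (𝟙 A) p (by simp [hσ])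
      retract := by ext <;> simp [hσ] } he
  have hσ' : weakEquivalences M σ :=
    (weakEquivalences M).of_postcomp σ p hp (by rw [hσ]; exact (weakEquivalences M).id_mem _)
  exact (weakEquivalences M).of_postcomp f σ hσ' h

/-- Part of the two-out-of-six property. -/
lemma weakEquivalences_of_two_out_of_six {X Y A B : M} {f : X ⟶ Y} {s : Y ⟶ A} {p : A ⟶ B}
    (h₁ : weakEquivalences M (f ≫ s)) (h₂ : weakEquivalences M (s ≫ p)) :
    weakEquivalences M f := by
  obtain ⟨A', i, p', hi, hp', rfl⟩ : ∃ (A' : M) (i : A ⟶ A') (p' : A' ⟶ B),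
      weakEquivalences M i ∧ fibrations M p' ∧ i ≫ p' = p :=
    let d := MorphismProperty.factorizationData (trivialCofibrations M) (fibrations M) p
    ⟨d.Z, d.i, d.p, d.hi.2, d.hp, d.fac⟩
  obtain ⟨W, j, r, hj, hr, hjr⟩ : ∃ (W : M) (j : Y ⟶ W) (r : W ⟶ B),
      trivialCofibrations M j ∧ fibrations M r ∧ j ≫ r = s ≫ i ≫ p' :=
    let d := MorphismProperty.factorizationData (trivialCofibrations M) (fibrations M) (s ≫ i ≫ p')
    ⟨d.Z, d.i, d.p, d.hi, d.hp, d.fac⟩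
  have hr' : weakEquivalences M r := (weakEquivalences M).of_precomp j r hj.2 (by rwa [hjr])
  have : HasLiftingProperty j p' := by
    rw [← MorphismProperty.llp_eq_of_wfs (trivialCofibrations M) (fibrations M)] at hj
    exact hj _ hp'
  have sq : CommSq (s ≫ i) j p' r := ⟨by rw [hjr, Category.assoc]⟩
  have hfst : trivialFibrations M (pullback.fst p' r) := by
    have hr : trivialFibrations M r := ⟨hr, hr'⟩
    rw [← MorphismProperty.rlp_eq_of_wfs (cofibrations M) (trivialFibrations M)] at hr ⊢
    exact MorphismProperty.pullback_fst _ _ hr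
  -- The lift extends `s ≫ i` along `j`, so `f ≫ j ≫ σ` lies over `f ≫ s ≫ i` through the trivial
  -- fibration `pullback.fst`, while `σ` is a section of `pullback.snd`.
  let σ : W ⟶ pullback p' r := pullback.lift sq.lift (𝟙 W) (by rw [sq.fac_right, Category.id_comp])
  have hfj : weakEquivalences M (f ≫ j) := by
    refine weakEquivalences_of_section (σ := σ) (p := pullback.snd p' r) (pullback.lift_snd _ _ _) ?_
    refine (weakEquivalences M).of_postcomp _ (pullback.fst p' r) hfst.2 ?_
    rw [Category.assoc, pullback.lift_fst, Category.assoc, sq.fac_left, ← Category.assoc]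
    exact (weakEquivalences M).comp_mem _ _ h₁ hi
  exact (weakEquivalences M).of_postcomp f j hj.2 hfj

/-- The face maps from `R 1` to `R 0` are weak equivalences, as `R` is levelwise equivalent to a
constant object. So the two ends of an edge `X ⟶ R 1` are weak equivalences together. -/
lemma weakEquivalences_of_eqvGen {A : M} {R : SimplicialObject M}
    {i : (SimplicialObject.const M).obj A ⟶ R} (hi : levelwiseWeq M i) {X : M}
    {x y : (homComplex X R) _⦋0⦌} (h : Relation.EqvGen SSet.π₀Rel x y) :
    weakEquivalences M (show X ⟶ R _⦋0⦌ from x) ↔ weakEquivalences M (show X ⟶ R _⦋0⦌ from y) := by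
  induction h with
  | rel x y h =>
    obtain ⟨z, rfl, rfl⟩ : ∃ z : X ⟶ R _⦋1⦌, z ≫ R.δ 1 = x ∧ z ≫ R.δ 0 = y :=
      ⟨h.some.edge, h.some.src_eq, h.some.tgt_eq⟩
    have hδ : ∀ k : Fin 2, weakEquivalences M (R.δ k) := fun k => by
      refine (weakEquivalences M).of_precomp (i.app _) (R.δ k) (hi _) ?_
      rw [SimplicialObject.δ, ← i.naturality]
      exact (weakEquivalences M).comp_mem _ _ ((weakEquivalences M).id_mem _) (hi _)
    exact ⟨fun h => (weakEquivalences M).comp_mem _ _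
        ((weakEquivalences M).of_postcomp _ _ (hδ 1) h) (hδ 0),
      fun h => (weakEquivalences M).comp_mem _ _
        ((weakEquivalences M).of_postcomp _ _ (hδ 0) h) (hδ 1)⟩
  | refl x => rfl
  | symm x y _ ih => exact ih.symm
  | trans x y z _ _ ih₁ ih₂ => exact ih₁.trans ih₂

variable [HasLimits M] [HasColimits M]

/-- A form of the Whitehead theorem. -/
lemma weakEquivalences_of_mapWeq {X Y : M} {f : X ⟶ Y} (hX : (modelClasses M).MapWeq X f)
    (hY : (modelClasses M).MapWeq Y f) : weakEquivalences M f := by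
  obtain ⟨RA, RB, iA, iB, r, hA, hB, hr⟩ := exists_resolution f
  let P : (modelClasses M).MapResolution f :=
    { A' := X, B' := Y, f' := f, a := 𝟙 X, b := 𝟙 Y
      weq_a := (weakEquivalences M).id_mem _
      weq_b := (weakEquivalences M).id_mem _
      comm := by simp
      RA := RA, RB := RB, iA := iA, iB := iB, resolution_iA := hA, resolution_iB := hB
      res := r, comm_res := hr }
  let x : X ⟶ RA _⦋0⦌ := iA.app _
  let y : Y ⟶ RB _⦋0⦌ := iB.app _
  have hxy : x ≫ r.app _ = f ≫ y := congr_app hr _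
  -- Surjectivity on π₀ for `Y` lifts the augmentation `y` to a candidate inverse `s` of `f`.
  obtain ⟨s, hs⟩ := (hY P).exists_eqvGen y
  change Y ⟶ RA _⦋0⦌ at s
  have h₂ : weakEquivalences M (s ≫ r.app _) := (weakEquivalences_of_eqvGen hB.weq hs).2 (hB.weq _)
  -- Both `f ≫ s` and `x` map under `r` to the component of `f ≫ y`; injectivity on π₀ for `X` puts
  -- them in one component.
  have h₁ : weakEquivalences M (f ≫ s) := by
    refine (weakEquivalences_of_eqvGen hA.weq (X := X) (x := f ≫ s) (y := x)
      ((hX P).eqvGen ?_)).2 (hA.weq _)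
    have h := eqvGen_map (homComplexPrecomp f RB) hs
    have e₁ : (homComplexPrecomp f RB).app _ ((homComplexMap Y r).app _ s) =
        (homComplexMap X r).app _ (f ≫ s) := (Category.assoc _ _ _).symm
    have e₂ : (homComplexPrecomp f RB).app _ y = (homComplexMap X r).app _ x := hxy.symm
    rwa [← e₁, ← e₂]
  exact weakEquivalences_of_two_out_of_six h₁ h₂

end

end Colocal

namespace Colocal

open Simplicial

/-! ## Algebras -/

section

variable {M : Type u} [Category.{v} M]

/-- The adjunction between free algebras and the forgetful functor on function complexes. -/
noncomputable def homComplexFree (T : Monad M) (Z : M) (R : SimplicialObject T.Algebra) :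
    homComplex (T.free.obj Z) R ≅ homComplex Z (R ⋙ T.forget) :=
  NatIso.ofComponents (fun n => (T.adj.homEquiv Z (R.obj n)).toIso) fun θ => by
    ext x
    exact T.adj.homEquiv_naturality_right x (R.map θ)

lemma homComplexMap_free (T : Monad M) (Z : M) {R R' : SimplicialObject T.Algebra} (φ : R ⟶ R') :
    homComplexMap (T.free.obj Z) φ ≫ (homComplexFree T Z R').hom =
      (homComplexFree T Z R).hom ≫ homComplexMap Z (Functor.whiskerRight φ T.forget) := by
  ext n x
  exact T.adj.homEquiv_naturality_right x (φ.app n)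

lemma sSetWeakEquivalence_free_iff (T : Monad M) (Z : M) {R R' : SimplicialObject T.Algebra}
    (φ : R ⟶ R') : SSetWeakEquivalence (homComplexMap (T.free.obj Z) φ) ↔
      SSetWeakEquivalence (homComplexMap Z (Functor.whiskerRight φ T.forget)) := by
  constructor
  · intro h
    refine .of_precomp (.of_isIso (homComplexFree T Z R).hom) ?_
    rw [← homComplexMap_free]
    exact h.comp (.of_isIso _)
  · intro h
    refine .of_postcomp (.of_isIso (homComplexFree T Z R').hom) ?_
    rw [homComplexMap_free]
    exact SSetWeakEquivalence.comp (.of_isIso _) h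

lemma hasLiftingProperty_free_map {T : Monad M} {A B : M} {i : A ⟶ B} {E D : T.Algebra} {p : E ⟶ D}
    (h : HasLiftingProperty i (T.forget.map p)) : HasLiftingProperty (T.free.map i) p :=
  (T.adj.hasLiftingProperty_iff _ _).2 h

lemma cof_free_map [ModelCategory M] (T : Monad M) {A B : M} {i : A ⟶ B} (hi : cofibrations M i) :
    (algClasses T (modelClasses M)).cof (T.free.map i) := by
  intro E D p hp
  rw [← MorphismProperty.llp_eq_of_wfs (cofibrations M) (trivialFibrations M)] at hi
  exact hasLiftingProperty_free_map (hi _ hp)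

lemma isCofibrant_free [HasColimits M] [ModelCategory M] (T : Monad M)
    [HasColimits T.Algebra] {X : M} (hX : cofibrations M (initial.to X)) :
    (algClasses T (modelClasses M)).IsCofibrant (T.free.obj X) := by
  intro E D p hp
  have := cof_free_map T hX p hp
  have : PreservesColimitsOfSize.{0, 0} T.free := T.adj.leftAdjoint_preservesColimits
  have e := initialIsInitial.to (T.free.obj (⊥_ M))
  rw [← initialIsInitial.hom_ext (e ≫ T.free.map (initial.to X)) (initial.to (T.free.obj X))]
  have : IsIso e := ⟨(initialIsInitial.isInitialObj T.free).to _, initialIsInitial.hom_ext _ _,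
    (initialIsInitial.isInitialObj T.free).hom_ext _ _⟩
  infer_instance

variable [HasLimits M]

lemma matchingMap_forget (T : Monad M) (R : SimplicialObject T.Algebra) (n : SimplexCategory) :
    T.forget.map (matchingMap R n) ≫ (preservesLimitIso T.forget (matchingDiagram R n)).hom =
      matchingMap (R ⋙ T.forget) n := by
  apply limit.hom_ext
  intro m
  refine (Category.assoc _ _ _).trans ((congrArg (T.forget.map (matchingMap R n) ≫ ·)
    (preservesLimitIso_hom_π T.forget (matchingDiagram R n) m)).trans ?_)
  rw [← Functor.map_comp, matchingMap_π]
  exact (matchingMap_π (R ⋙ T.forget) n m).symm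

variable [ModelCategory M]

lemma isReedyFibrant_forget (T : Monad M) {R : SimplicialObject T.Algebra}
    (h : (algClasses T (modelClasses M)).IsReedyFibrant R) :
    (modelClasses M).IsReedyFibrant (R ⋙ T.forget) := fun n => by
  rw [← matchingMap_forget]
  exact (MorphismProperty.cancel_right_of_respectsIso (fibrations M) _ _).2 (h n)

/-- The coaugmentation of the underlying simplicial object. -/
def forgetAugmentation (T : Monad M) {A : T.Algebra} {R : SimplicialObject T.Algebra}
    (i : (SimplicialObject.const _).obj A ⟶ R) :
    (SimplicialObject.const M).obj (T.forget.obj A) ⟶ R ⋙ T.forget where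
  app n := T.forget.map (i.app n)
  naturality n m θ := by
    have h := congrArg T.forget.map (i.naturality θ)
    rw [Functor.map_comp, Functor.map_comp] at h
    refine Eq.trans ?_ h
    exact congrArg (· ≫ T.forget.map (i.app m)) (T.forget.map_id A).symm

lemma isSimplicialResolution_forget (T : Monad M) {A : T.Algebra} {R : SimplicialObject T.Algebra}
    {i : (SimplicialObject.const _).obj A ⟶ R}
    (h : (algClasses T (modelClasses M)).IsSimplicialResolution i) :
    (modelClasses M).IsSimplicialResolution (forgetAugmentation T i) :=
  ⟨fun n => h.weq n, isReedyFibrant_forget T h.reedyFibrant⟩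

/-- The resolution of the underlying map of a map of algebras. -/
def forgetMapResolution (T : Monad M) {A B : T.Algebra} {g : A ⟶ B}
    (P : (algClasses T (modelClasses M)).MapResolution g) :
    (modelClasses M).MapResolution (T.forget.map g) where
  A' := T.forget.obj P.A'
  B' := T.forget.obj P.B'
  f' := T.forget.map P.f'
  a := T.forget.map P.a
  b := T.forget.map P.b
  weq_a := P.weq_a
  weq_b := P.weq_b
  comm := by rw [← Functor.map_comp, P.comm, Functor.map_comp]
  RA := P.RA ⋙ T.forget
  RB := P.RB ⋙ T.forget
  iA := forgetAugmentation T P.iA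
  iB := forgetAugmentation T P.iB
  resolution_iA := isSimplicialResolution_forget T P.resolution_iA
  resolution_iB := isSimplicialResolution_forget T P.resolution_iB
  res := Functor.whiskerRight P.res T.forget
  comm_res := by
    ext n
    have h := congrArg T.forget.map (congr_app P.comm_res n)
    exact (T.forget.map_comp _ _).symm.trans (h.trans (T.forget.map_comp _ _))

lemma mapWeq_free (T : Monad M) {Z : M} {A B : T.Algebra} {g : A ⟶ B}
    (h : (modelClasses M).MapWeq Z (T.forget.map g)) :
    (algClasses T (modelClasses M)).MapWeq (T.free.obj Z) g := fun P =>
  (sSetWeakEquivalence_free_iff T Z P.res).2 (h (forgetMapResolution T P))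

variable [HasColimits M]

/-- The hypothesis `h` has content only if some resolution `P` of algebras exists. It controls the
underlying resolution of `P`, and independence passes to an arbitrary resolution in `M`. -/
lemma mapWeq_of_mapWeq_free (T : Monad M) {Z : M} (hZ : cofibrations M (initial.to Z))
    {A B : T.Algebra} {g : A ⟶ B} (P : (algClasses T (modelClasses M)).MapResolution g)
    (h : (algClasses T (modelClasses M)).MapWeq (T.free.obj Z) g) :
    (modelClasses M).MapWeq Z (T.forget.map g) := fun Q =>
  Classes.MapResolution.sSetWeakEquivalence hZ (forgetMapResolution T P) Q
    ((sSetWeakEquivalence_free_iff T Z P.res).1 (h P))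

/-- By two-out-of-three, any resolution of a weak equivalence has as underlying map a levelwise weak
equivalence between Reedy fibrant objects. -/
lemma colocalEquivalences_of_weq {T : Monad M} {K : Set M}
    (hK : ∀ X ∈ K, (modelClasses M).IsCofibrant X) {A B : T.Algebra} {g : A ⟶ B}
    (hg : (algClasses T (modelClasses M)).weq g) :
    (algClasses T (modelClasses M)).colocalEquivalences (freeSet T K) g := by
  rintro _ ⟨Z, hZ, rfl⟩ P
  rw [sSetWeakEquivalence_free_iff]
  let Q := forgetMapResolution T P
  have hf' : weakEquivalences M Q.f' := by
    have hb : weakEquivalences M Q.b := Q.weq_b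
    refine (weakEquivalences M).of_postcomp _ _ hb ?_
    rw [← Q.comm]
    exact (weakEquivalences M).comp_mem _ _ Q.weq_a hg
  refine sSetWeakEquivalence_of_levelwiseWeq (hK Z hZ) ?_ Q.resolution_iA.reedyFibrant
    Q.resolution_iB.reedyFibrant
  refine levelwiseWeq.of_precomp Q.resolution_iA.weq ?_
  have := (levelwiseWeq_const hf').comp Q.resolution_iB.weq
  rwa [← Q.comm_res] at this

variable {T : Monad M} [HasColimits T.Algebra]

/-- Retract argument: `T.free.map j` lifts against all fibrations of algebras by adjunction, so it
is a retract of the trivial cofibration in its factorization, which exists because the domain is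
cofibrant. -/
lemma weq_free_map_of_trivialCofibration (hT : IsSemiAdmissible T (modelClasses M)) {X W : M}
    (hX : cofibrations M (initial.to X)) {j : X ⟶ W} (hj : trivialCofibrations M j) :
    (algClasses T (modelClasses M)).weq (T.free.map j) := by
  obtain ⟨Z, i, p, hi, hp, hfac⟩ : ∃ (Z : T.Algebra) (i : T.free.obj X ⟶ Z)
      (p : Z ⟶ T.free.obj W), (algClasses T (modelClasses M)).trivCof i ∧
        (algClasses T (modelClasses M)).fib p ∧ i ≫ p = T.free.map j := by
    obtain ⟨Z, i, p, h⟩ := hT.factor_trivCof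
    exact ⟨_, _, _, h ⟨Arrow.mk (T.free.map j), isCofibrant_free T hX⟩⟩
  have : HasLiftingProperty (T.free.map j) p := by
    rw [← MorphismProperty.llp_eq_of_wfs (trivialCofibrations M) (fibrations M)] at hj
    exact hasLiftingProperty_free_map (hj _ hp)
  have := hT.weq_retract
  exact MorphismProperty.of_retract (P := (algClasses T (modelClasses M)).weq)
    (RetractArrow.ofLeftLiftingProperty hfac) hi.2

/-- Ken Brown's lemma: `f` is a trivial cofibration followed by a retraction of another trivial
cofibration. -/
lemma weq_free_map (hT : IsSemiAdmissible T (modelClasses M)) {X Y : M}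
    (hX : cofibrations M (initial.to X)) (hY : cofibrations M (initial.to Y)) {f : X ⟶ Y}
    (hf : weakEquivalences M f) : (algClasses T (modelClasses M)).weq (T.free.map f) := by
  have : IsCofibrant X := ⟨hX⟩
  have : IsCofibrant Y := ⟨hY⟩
  have : WeakEquivalence f := ⟨hf⟩
  let b : CofibrantBrownFactorization f := Classical.arbitrary _
  have := hT.twoOutOfThree
  let W := (algClasses T (modelClasses M)).weq
  have hi : W (T.free.map b.i) := weq_free_map_of_trivialCofibration hT hX
    ⟨b.hi, mem_weakEquivalences b.i⟩
  have hs : W (T.free.map b.s) := weq_free_map_of_trivialCofibration hT hY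
    ⟨mem_cofibrations b.s, mem_weakEquivalences b.s⟩
  have hp : W (T.free.map b.p) := by
    refine W.of_precomp _ _ hs ?_
    rw [← Functor.map_comp, b.s_p, CategoryTheory.Functor.map_id]
    exact (weakEquivalences M).id_mem _
  rw [← b.fac, Functor.map_comp]
  exact W.comp_mem _ _ hi hp

/-- The resolution `P` on which the claim is tested is also the one that makes the underlying map of
a T(K)-colocal equivalence K-colocal. -/
lemma isColocal_free {K : Set M} (hK : ∀ X ∈ K, (modelClasses M).IsCofibrant X) {X : M}
    (hX : (modelClasses M).IsColocal K X) :
    (algClasses T (modelClasses M)).IsColocal (freeSet T K) (T.free.obj X) where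
  cofibrant := isCofibrant_free T hX.cofibrant
  mapWeq _ _ _ hg P := mapWeq_free T (hX.mapWeq _ fun Z hZ =>
    mapWeq_of_mapWeq_free T (hK Z hZ) P (hg _ ⟨Z, hZ, rfl⟩)) P

end

end Colocal

theorem mainTheorem9 {M : Type u} [Category.{v} M] [HasLimits M] [HasColimits M]
    [ModelCategory M]
    (T : Monad M) [HasColimits T.Algebra]
    (K : Set M) (hK : ∀ X ∈ K, (Colocal.modelClasses M).IsCofibrant X)
    (hRK : ((Colocal.modelClasses M).rightBousfield K).IsModel)
    (hT : Colocal.IsSemiAdmissible T (Colocal.modelClasses M))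
    (h : Colocal.IsSemiAdmissible T ((Colocal.modelClasses M).rightBousfield K) ∨
      Colocal.HasFreeRightBousfield T (Colocal.modelClasses M) K)
    {X Y : M} (f : X ⟶ Y)
    (hX : (Colocal.modelClasses M).IsColocal K X)
    (hY : (Colocal.modelClasses M).IsColocal K Y)
    (hf : (Colocal.modelClasses M).colocalEquivalences K f) :
    (Colocal.algClasses T (Colocal.modelClasses M)).IsColocal (Colocal.freeSet T K)
        (T.free.obj X) ∧
      (Colocal.algClasses T (Colocal.modelClasses M)).IsColocal (Colocal.freeSet T K)
        (T.free.obj Y) ∧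
      (Colocal.algClasses T (Colocal.modelClasses M)).colocalEquivalences (Colocal.freeSet T K)
        (T.free.map f) := by
  have hw := Colocal.weakEquivalences_of_mapWeq (hX.mapWeq f hf) (hY.mapWeq f hf)
  exact ⟨Colocal.isColocal_free hK hX, Colocal.isColocal_free hK hY,
    Colocal.colocalEquivalences_of_weq hK (Colocal.weq_free_map hT hX.cofibrant hY.cofibrant hw)⟩
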